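/- Let $\varphi\in C^2(\mathbb R^2\to\mathbb R)$, and let $\psi\in C^1(\mathbb R\to\mathbb R)$ be strictly increasing with $\psi(0)=0$ and $\sup_{u}\psi'(\psi^{-1}(u))<\infty$ (the supremum over the range of $\psi$). Let $k_n>0$ and $u_r>0$ be constants. Put $\mathcal P=\{r\in\mathbb R^2:\varphi(r)=0\}$, $e=\psi\circ\varphi$, $n=\nabla\varphi$, $\mathcal C_0=\{r\in\mathbb R^2: n(r)=0\}$, $E=\begin{bmatrix}0&1\\-1&0\end{bmatrix}$, $$v(r)=E\,n(r)-k_n e(r)\,n(r)\quad(r\in\mathbb R^2),\qquad m_d(r)=\frac{v(r)}{|v(r)|}\quad(r\notin\mathcal C_0),$$ and let $H(r)$ be the Hessian matrix of $\varphi$ at $r$. Let $\operatorname{dist}(r,A)=\inf_{a\in A}|r-a|$ and $\operatorname{dist}(A,B)=\inf_{a\in A,\,b\in B}|a-b|$, with $\inf\emptyset=+\infty$. Assume that 1. $\inf\{|e(r)|:\operatorname{dist}(r,\mathcal P)\ge\kappa\}>0$ for every $\kappa>0$; 2. $\operatorname{dist}(\mathcal C_0,\mathcal P)>0$; 3. $\inf\{|n(r)|:\operatorname{dist}(r,\mathcal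 C_0)\ge\kappa\}>0$ for every $\kappa>0$; 4. $\mathcal C_0$ is finite. Consider the differential equation $$\dot r(t)=u_r\,m_d(r(t)),\qquad t\ge 0,\tag{1}$$ whose solutions take values in $\mathbb R^2\setminus\mathcal C_0$. Say that $r_0\in\mathbb R^2$ is *good* if (1) has a solution on $[0,\infty)$ with $r(0)=r_0$, and every solution of (1) with $r(0)=r_0$, defined on an interval $[0,T)$ with $0<T\le\infty$, can be prolonged to a solution on $[0,\infty)$ such that $\operatorname{dist}(r(t),\mathcal P)\to0$ as $t\to\infty$. (a) If for every $\xi\in\mathcal C_0$ the symmetric matrix $e(\xi)H(\xi)$ has a negative eigenvalue, then (Lebesgue) almost every $r_0\in\mathbb R^2$ is good. (b) If for every $\xi\in\mathcal C_0$ the matrix $e(\xi)H(\xi)$ is negative definite, then every $r_0\in\mathbb R^2\setminus\mathcal C_0$ is good. -/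

import Mathlib

open scoped Topology

noncomputable section

namespace GVF

/-- The Euclidean plane `ℝ²`. -/
abbrev Plane : Type := EuclideanSpace ℝ (Fin 2)

/-- The desired path `P = {φ = 0}`. -/
def path (φ : Plane → ℝ) : Set Plane := {p | φ p = 0}

/-- The tracking error `e = ψ ∘ φ`. -/
def err (φ : Plane → ℝ) (ψ : ℝ → ℝ) (p : Plane) : ℝ := ψ (φ p)

/-- The normal vector `n = ∇φ`. -/
def normal (φ : Plane → ℝ) (p : Plane) : Plane := gradient φ p

/-- The tangent vector `τ = E n`, where `E` is the matrix with rows `(0, 1)` and `(-1, 0)`. -/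
def tangent (φ : Plane → ℝ) (p : Plane) : Plane := !₂[normal φ p 1, -normal φ p 0]

/-- The set `C₀` of critical points of `φ`. -/
def critSet (φ : Plane → ℝ) : Set Plane := {p | normal φ p = 0}

/-- The Hessian matrix of `φ`; its `(i, j)` entry is `∂ᵢ ∂ⱼ φ`. -/
def hessian (φ : Plane → ℝ) (p : Plane) : Matrix (Fin 2) (Fin 2) ℝ :=
  Matrix.of fun i j =>
    fderiv ℝ (fun q => fderiv ℝ φ q (EuclideanSpace.single j 1)) p (EuclideanSpace.single i 1)

/-- The vector field `v = τ - kₙ e n`. -/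
def field (φ : Plane → ℝ) (ψ : ℝ → ℝ) (kn : ℝ) (p : Plane) : Plane :=
  tangent φ p - (kn * err φ ψ p) • normal φ p

/-- The guiding vector field `m_d = v / |v|`. It is meaningful off the critical set only; solutions
of the guidance equation are required below to avoid the critical set. -/
def guide (φ : Plane → ℝ) (ψ : ℝ → ℝ) (kn : ℝ) (p : Plane) : Plane :=
  ‖field φ ψ kn p‖⁻¹ • field φ ψ kn p

/-- Every point at distance at least `κ > 0` from the path has `|e|` bounded away from `0`:
`inf {|e(p)| : dist(p, P) ≥ κ} > 0` (the infimum of the empty set is `+∞`). -/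
def ErrSeparated (φ : Plane → ℝ) (ψ : ℝ → ℝ) : Prop :=
  ∀ κ : ℝ, 0 < κ → ∃ c : ℝ, 0 < c ∧
    ∀ p, ENNReal.ofReal κ ≤ Metric.infEDist p (path φ) → c ≤ |err φ ψ p|

/-- `dist(C₀, P) > 0` (the distance to an empty set is `+∞`). -/
def CritSeparated (φ : Plane → ℝ) : Prop :=
  0 < ⨅ p ∈ critSet φ, Metric.infEDist p (path φ)

/-- `inf {|n(p)| : dist(p, C₀) ≥ κ} > 0` for every `κ > 0` (the distance to an empty set and the
infimum of the empty set are `+∞`). -/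
def NormalSeparated (φ : Plane → ℝ) : Prop :=
  ∀ κ : ℝ, 0 < κ → ∃ c : ℝ, 0 < c ∧
    ∀ p, ENNReal.ofReal κ ≤ Metric.infEDist p (critSet φ) → c ≤ ‖normal φ p‖

/-- The time interval `[0, T)`, where `T` may be `+∞`. -/
def timeInterval (T : EReal) : Set ℝ := {t | 0 ≤ t ∧ (t : EReal) < T}

/-- `r` solves `ṙ = u_r m_d(r)` on `[0, T)` with `r(0) = r₀`. The right-hand side is defined off the
critical set only, so that `r` has to stay off it. The values of `r` outside `[0, T)` are
irrelevant; the derivative at `0` is one-sided. -/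
structure IsSolution (φ : Plane → ℝ) (ψ : ℝ → ℝ) (kn ur : ℝ) (r₀ : Plane) (T : EReal)
    (r : ℝ → Plane) : Prop where
  init : r 0 = r₀
  regular : ∀ t ∈ timeInterval T, r t ∉ critSet φ
  ode : IsIntegralCurveOn r (fun _ p => ur • guide φ ψ kn p) (timeInterval T)

/-- The motion `ṙ = u_r m_d(r)` with `r(0) = r₀` has a solution on `[0, ∞)`, and every solution
on an interval `[0, T)` with `0 < T ≤ ∞` can be prolonged to a solution on `[0, ∞)` that
converges to the path. For `T = ∞` this says that every solution on `[0, ∞)` converges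
to the path. -/
def GlobalConvergence (φ : Plane → ℝ) (ψ : ℝ → ℝ) (kn ur : ℝ) (r₀ : Plane) : Prop :=
  (∃ r, IsSolution φ ψ kn ur r₀ ⊤ r) ∧
  ∀ T : EReal, 0 < T → ∀ r, IsSolution φ ψ kn ur r₀ T r →
    ∃ R, IsSolution φ ψ kn ur r₀ ⊤ R ∧ Set.EqOn R r (timeInterval T) ∧
      Filter.Tendsto (fun t => Metric.infEDist (R t) (path φ)) Filter.atTop (𝓝 0)

end GVF

end

/-!
Along a solution the rotation `E ∇φ` does not change `φ`, so that `φ²` decreases, at a rate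
governed by `φ e ‖∇φ‖`. A solution of bounded speed either lasts forever or runs into a critical
point in finite time (`exists_isSol_top_or_tendsto`); if it lasts forever, then either `φ → 0`, and
the solution converges to the path, or `∇φ` is small most of the time, and the solution converges to
one of the finitely many critical points (`IsSol.tendsto_path_or_crit`). So convergence to a critical
point `ξ`, in finite or infinite time, is all that has to be excluded.

In the time of the unnormalized field `v`, for which `ξ` is an equilibrium, such a solution is
defined for all future times and eventually stays in any given ball around `ξ`
(`IsSol.eventually_trapped`). The linearization of `v` at `ξ` is `(E - kₙ e) H`. For the quadratic
form `Q(w) = -e ⟨w, H w⟩` its derivative along the linear flow is `2 kₙ ‖e H w‖²`, because `E` is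
skew. Hence the difference `w` of two orbits that remain near `ξ` cannot satisfy
`Q(w) > δ ‖w‖²`, since otherwise `Q(w) - δ ‖w‖²` would grow without bound
(`exists_forall_trapped_inner_le`). No invariant manifold theorem is needed, and the remaining
eigenvalue of `H` may have any sign or vanish.

If `e H` is negative definite, comparison with the equilibrium shows that `ξ` itself is the only
trapped point (`badSet_eq_empty`). If `e H` has a negative eigenvalue, the trapped points lie on a
Lipschitz graph over the line orthogonal to the eigenvector, a set of Hausdorff dimension at most `1`;
by Grönwall's inequality backwards in time so are the sets of initial points that are trapped at a
given time after a motion in a given compact set, and countably many of these cover all initial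
points of solutions converging to `ξ` (`volume_badSet`).
-/

noncomputable section

namespace GVF

open Set Filter

/-! ### Solutions of an autonomous equation in an open set -/

section ODE

variable {E : Type*} [NormedAddCommGroup E] [NormedSpace ℝ E]

/-- `x` solves `ẋ = f x` on `[0, T)` with `x 0 = x₀` and values in `U`. Derivatives are taken within
`[0, ∞)` whatever `T` is, which is the same as within `[0, T)` at the times concerned. -/
structure IsSol (f : E → E) (U : Set E) (x₀ : E) (T : EReal) (x : ℝ → E) : Prop where
  init : x 0 = x₀
  mem : ∀ t : ℝ, 0 ≤ t → (t : EReal) < T → x t ∈ U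
  deriv : ∀ t : ℝ, 0 ≤ t → (t : EReal) < T → HasDerivWithinAt x (f (x t)) (Ici 0) t

variable {f : E → E} {U : Set E} {x₀ : E} {T T' : EReal} {x y : ℝ → E}

lemma IsSol.congr (h : IsSol f U x₀ T x) (hT : 0 < T)
    (hxy : ∀ t : ℝ, 0 ≤ t → (t : EReal) < T → y t = x t) : IsSol f U x₀ T y := by
  refine ⟨by rw [hxy 0 le_rfl (by simpa using hT), h.init],
    fun t h0 ht => by rw [hxy t h0 ht]; exact h.mem t h0 ht, fun t h0 ht => ?_⟩
  rw [hxy t h0 ht]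
  refine (h.deriv t h0 ht).congr_of_eventuallyEq ?_ (hxy t h0 ht)
  have : ∀ᶠ s : ℝ in 𝓝 t, (s : EReal) < T :=
    continuous_coe_real_ereal.continuousAt.eventually_lt continuousAt_const ht
  filter_upwards [nhdsWithin_le_nhds this, self_mem_nhdsWithin] with s hs hs0 using hxy s hs0 hs

lemma IsSol.hasDerivWithinAt_Ici (h : IsSol f U x₀ T x) {t : ℝ} (h0 : 0 ≤ t)
    (ht : (t : EReal) < T) : HasDerivWithinAt x (f (x t)) (Ici t) t :=
  (h.deriv t h0 ht).mono (Ici_subset_Ici.2 h0)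

lemma IsSol.hasDerivAt (h : IsSol f U x₀ T x) {t : ℝ} (h0 : 0 < t) (ht : (t : EReal) < T) :
    HasDerivAt x (f (x t)) t :=
  (h.deriv t h0.le ht).hasDerivAt (Ici_mem_nhds h0)

lemma IsSol.continuousOn (h : IsSol f U x₀ T x) {b : ℝ} (hb : (b : EReal) < T) :
    ContinuousOn x (Icc 0 b) := fun t ht =>
  ((h.deriv t ht.1 ((EReal.coe_le_coe_iff.2 ht.2).trans_lt hb)).continuousWithinAt).mono
    Icc_subset_Ici_self

lemma exists_lipschitzOnWith_of_isCompact (hf : ∀ p ∈ U, ContDiffAt ℝ 1 f p) {K : Set E}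
    (hK : IsCompact K) (hKU : K ⊆ U) : ∃ C, LipschitzOnWith C f K := by
  refine LocallyLipschitzOn.exists_lipschitzOnWith_of_compact hK fun p hp => ?_
  obtain ⟨C, s, hs, h⟩ := (hf p (hKU hp)).exists_lipschitzOnWith
  exact ⟨C, s, nhdsWithin_le_nhds hs, h⟩

lemma IsSol.unique (hf : ∀ p ∈ U, ContDiffAt ℝ 1 f p) (hx : IsSol f U x₀ T x)
    (hy : IsSol f U x₀ T' y) {t : ℝ} (h0 : 0 ≤ t) (ht : (t : EReal) < T)
    (ht' : (t : EReal) < T') : x t = y t := by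
  have hlt : ∀ {s : ℝ} {S : EReal}, s ≤ t → (t : EReal) < S → (s : EReal) < S := fun hs hS =>
    (EReal.coe_le_coe_iff.2 hs).trans_lt hS
  have hcx := hx.continuousOn ht
  have hcy := hy.continuousOn ht'
  obtain ⟨C, hC⟩ := exists_lipschitzOnWith_of_isCompact hf
    ((isCompact_Icc.image_of_continuousOn hcx).union (isCompact_Icc.image_of_continuousOn hcy))
    (by
      rintro _ (⟨s, hs, rfl⟩ | ⟨s, hs, rfl⟩)
      · exact hx.mem s hs.1 (hlt hs.2 ht)
      · exact hy.mem s hs.1 (hlt hs.2 ht'))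
  exact ODE_solution_unique_of_mem_Icc_right (v := fun _ => f) (fun _ _ => hC) hcx
    (fun s hs => hx.hasDerivWithinAt_Ici hs.1 (hlt hs.2.le ht))
    (fun s hs => Or.inl ⟨s, Ico_subset_Icc_self hs, rfl⟩) hcy
    (fun s hs => hy.hasDerivWithinAt_Ici hs.1 (hlt hs.2.le ht'))
    (fun s hs => Or.inr ⟨s, Ico_subset_Icc_self hs, rfl⟩) (by rw [hx.init, hy.init])
    ⟨h0, le_rfl⟩

/-- A solution with a limit in `U` at a finite time can be continued: the Picard–Lindelöf solution
through the limit is appended, and the derivative at the junction is the limit of the derivatives. -/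
lemma IsSol.exists_extension [CompleteSpace E] (hU : IsOpen U) (hf : ∀ p ∈ U, ContDiffAt ℝ 1 f p)
    {T : ℝ} (hT : 0 < T) (hx : IsSol f U x₀ T x) {p : E} (hp : p ∈ U)
    (hlim : Tendsto x (𝓝[<] T) (𝓝 p)) :
    ∃ T' : ℝ, T < T' ∧ ∃ y, IsSol f U x₀ T' y := by
  obtain ⟨α, hα0, ε, hε, hα⟩ :=
    (hf p hp).exists_forall_mem_closedBall_exists_eq_forall_mem_Ioo_hasDerivAt₀ T
  have hTmem : T ∈ Ioo (T - ε) (T + ε) := ⟨by linarith, by linarith⟩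
  have hαU : ∀ᶠ t in 𝓝 T, α t ∈ U :=
    (hα T hTmem).continuousAt.eventually_mem (hU.mem_nhds (by rwa [hα0]))
  obtain ⟨η, hη, hηU⟩ := Metric.eventually_nhds_iff.1 hαU
  set y : ℝ → E := fun t => if t < T then x t else α t with hy
  have hyx : ∀ t, t < T → y t = x t := fun t ht => by simp [hy, ht]
  have hyα : ∀ t, T ≤ t → y t = α t := fun t ht => by simp [hy, not_lt.2 ht]
  have hlt : ∀ {t : ℝ}, t < T → (t : EReal) < (T : EReal) := fun h => EReal.coe_lt_coe_iff.2 h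
  have hyT : y T = p := by rw [hyα T le_rfl, hα0]
  have hev : ∀ᶠ t in 𝓝[<] T, 0 < t ∧ t < T :=
    (eventually_nhdsWithin_of_eventually_nhds (lt_mem_nhds hT)).and self_mem_nhdsWithin
  have hlimy : Tendsto y (𝓝[<] T) (𝓝 p) :=
    hlim.congr' (by filter_upwards [hev] with t ht using (hyx t ht.2).symm)
  have hderiv : ∀ t, 0 < t → t < T → HasDerivAt y (f (y t)) t := fun t h0 ht => by
    rw [hyx t ht]
    exact (hx.hasDerivAt h0 (hlt ht)).congr_of_eventuallyEq
      (by filter_upwards [Iio_mem_nhds ht] with s hs using hyx s hs)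
  have hleft : HasDerivWithinAt y (f (y T)) (Iic T) T := by
    rw [hyT]
    refine hasDerivWithinAt_Iic_of_tendsto_deriv (s := Ioo 0 T)
      (fun t ht => (hderiv t ht.1 ht.2).differentiableAt.differentiableWithinAt) ?_
      (Ioo_mem_nhdsLT hT) ?_
    · rw [ContinuousWithinAt, hyT]
      exact hlimy.mono_left (nhdsWithin_mono _ Ioo_subset_Iio_self)
    · refine ((hf p hp).continuousAt.tendsto.comp hlimy).congr' ?_
      filter_upwards [hev] with t ht using (hderiv t ht.1 ht.2).deriv.symm
  have hright : HasDerivWithinAt y (f (y T)) (Ici T) T := by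
    rw [hyα T le_rfl]
    exact (hα T hTmem).hasDerivWithinAt.congr (fun t ht => hyα t ht) (hyα T le_rfl)
  refine ⟨T + min ε η, by simp [hε, hη], y, ?_, fun t h0 ht => ?_, fun t h0 ht => ?_⟩
  · rw [hyx 0 hT, hx.init]
  · replace ht := EReal.coe_lt_coe_iff.1 ht
    rcases lt_or_ge t T with h | h
    · rw [hyx t h]; exact hx.mem t h0 (hlt h)
    · rw [hyα t h]
      apply hηU
      rw [Real.dist_eq, abs_of_nonneg (by linarith)]
      linarith [min_le_right ε η]
  · replace ht := EReal.coe_lt_coe_iff.1 ht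
    rcases lt_trichotomy t T with h | rfl | h
    · rw [hyx t h]
      exact (hx.deriv t h0 (hlt h)).congr_of_eventuallyEq
        (by filter_upwards [nhdsWithin_le_nhds (Iio_mem_nhds h)] with s hs using hyx s hs)
        (hyx t h)
    · have := hleft.union hright
      rw [Iic_union_Ici] at this
      exact this.mono (subset_univ _)
    · rw [hyα t h.le]
      refine ((hα t ⟨by linarith, ?_⟩).congr_of_eventuallyEq ?_).hasDerivWithinAt
      · linarith [min_le_left ε η]
      · filter_upwards [Ioi_mem_nhds h] with s hs using hyα s (le_of_lt hs)

lemma exists_isSol [CompleteSpace E] (hU : IsOpen U) (hf : ∀ p ∈ U, ContDiffAt ℝ 1 f p)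
    (hx₀ : x₀ ∈ U) : ∃ T : ℝ, 0 < T ∧ ∃ x, IsSol f U x₀ T x := by
  obtain ⟨α, hα0, ε, hε, hα⟩ :=
    (hf x₀ hx₀).exists_forall_mem_closedBall_exists_eq_forall_mem_Ioo_hasDerivAt₀ 0
  have hαU : ∀ᶠ t in 𝓝 0, α t ∈ U :=
    (hα 0 ⟨by linarith, by linarith⟩).continuousAt.eventually_mem (hU.mem_nhds (by rwa [hα0]))
  obtain ⟨η, hη, hηU⟩ := Metric.eventually_nhds_iff.1 hαU
  refine ⟨min ε η, by simp [hε, hη], α, hα0, fun t h0 ht => ?_, fun t h0 ht => ?_⟩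
  · apply hηU
    rw [Real.dist_eq, sub_zero, abs_of_nonneg h0]
    exact (EReal.coe_lt_coe_iff.1 ht).trans_le (min_le_right _ _)
  · refine (hα t ⟨by linarith, ?_⟩).hasDerivWithinAt
    linarith [min_le_left ε η, EReal.coe_lt_coe_iff.1 ht]

/-- If `f` is bounded on `U`, the only way for a solution not to be global is to converge, in
finite time, to a point outside `U`. -/
lemma exists_isSol_top_or_tendsto [CompleteSpace E] (hU : IsOpen U)
    (hf : ∀ p ∈ U, ContDiffAt ℝ 1 f p) {B : NNReal} (hB : ∀ p ∈ U, ‖f p‖₊ ≤ B) (hx₀ : x₀ ∈ U) :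
    (∃ x, IsSol f U x₀ ⊤ x) ∨
      ∃ T : ℝ, 0 < T ∧ ∃ x, IsSol f U x₀ T x ∧ ∃ p ∉ U, Tendsto x (𝓝[<] T) (𝓝 p) := by
  classical
  set A : Set ℝ := {T | 0 < T ∧ ∃ x, IsSol f U x₀ T x} with hA
  have hne : A.Nonempty := exists_isSol hU hf hx₀
  choose! X hX using fun T (hT : T ∈ A) => hT.2
  -- the maximal solution, glued from the local ones
  set G : ℝ → E := fun t => if h : ∃ T ∈ A, t < T then X h.choose t else x₀ with hG
  have hGX : ∀ T ∈ A, IsSol f U x₀ T G := fun T hT => by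
    refine (hX T hT).congr (by exact_mod_cast hT.1) fun t h0 ht => ?_
    have h : ∃ T ∈ A, t < T := ⟨T, hT, EReal.coe_lt_coe_iff.1 ht⟩
    simp only [hG, h, dif_pos]
    exact (hX _ h.choose_spec.1).unique hf (hX T hT) h0
      (EReal.coe_lt_coe_iff.2 h.choose_spec.2) ht
  have hG0 : G 0 = x₀ := (hGX _ hne.some_mem).init
  by_cases hbdd : BddAbove A
  swap
  · left
    rw [not_bddAbove_iff] at hbdd
    refine ⟨G, hG0, fun t h0 _ => ?_, fun t h0 _ => ?_⟩
    all_goals obtain ⟨T, hT, htT⟩ := hbdd t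
    · exact (hGX T hT).mem t h0 (EReal.coe_lt_coe_iff.2 htT)
    · exact (hGX T hT).deriv t h0 (EReal.coe_lt_coe_iff.2 htT)
  · right
    set S := sSup A with hS
    have hS0 : 0 < S := hne.some_mem.1.trans_le (le_csSup hbdd hne.some_mem)
    have hsol : IsSol f U x₀ S G := by
      refine ⟨hG0, fun t h0 ht => ?_, fun t h0 ht => ?_⟩
      all_goals obtain ⟨T, hT, htT⟩ := exists_lt_of_lt_csSup hne (EReal.coe_lt_coe_iff.1 ht)
      · exact (hGX T hT).mem t h0 (EReal.coe_lt_coe_iff.2 htT)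
      · exact (hGX T hT).deriv t h0 (EReal.coe_lt_coe_iff.2 htT)
    have hlip : LipschitzOnWith B G (Ico 0 S) :=
      (convex_Ico 0 S).lipschitzOnWith_of_nnnorm_hasDerivWithin_le
        (fun t ht => (hsol.deriv t ht.1 (EReal.coe_lt_coe_iff.2 ht.2)).mono Ico_subset_Ici_self)
        (fun t ht => hB _ (hsol.mem t ht.1 (EReal.coe_lt_coe_iff.2 ht.2)))
    have hcauchy : Cauchy (map G (𝓝[<] S)) := by
      refine Cauchy.map_of_le (cauchy_nhds.mono nhdsWithin_le_nhds) hlip.uniformContinuousOn ?_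
      exact le_principal_iff.2 (Ico_mem_nhdsLT hS0)
    obtain ⟨p, hp⟩ := cauchy_iff_exists_le_nhds.1 hcauchy
    refine ⟨S, hS0, G, hsol, p, fun hpU => ?_, hp⟩
    obtain ⟨T', hT', y, hy⟩ := hsol.exists_extension hU hf hS0 hpU hp
    exact absurd (le_csSup hbdd (show T' ∈ A from ⟨hS0.trans hT', y, hy⟩)) (not_le.2 hT')

/-- Grönwall's inequality backwards in time: initial points depend on final points in a Lipschitz
way, uniformly over the solutions that stay in `K` up to time `q`. -/
lemma dist_init_le_of_lipschitzOnWith {K : Set E} {C : NNReal} (hC : LipschitzOnWith C f K)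
    {y₀ : E} (hx : IsSol f U x₀ T x) (hy : IsSol f U y₀ T' y) {q : ℝ} (hq : 0 ≤ q)
    (hqT : (q : EReal) < T) (hqT' : (q : EReal) < T') (hxK : ∀ t ∈ Icc 0 q, x t ∈ K)
    (hyK : ∀ t ∈ Icc 0 q, y t ∈ K) :
    dist x₀ y₀ ≤ Real.exp (C * q) * dist (x q) (y q) := by
  have hmaps : MapsTo (fun s => q - s) (Icc 0 q) (Icc 0 q) := fun s hs =>
    ⟨by linarith [hs.2], by linarith [hs.1]⟩
  have key : ∀ {z₀ : E} {S : EReal} {z : ℝ → E}, IsSol f U z₀ S z → (q : EReal) < S →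
      ContinuousOn (fun s => z (q - s)) (Icc 0 q) ∧
      ∀ s ∈ Ico 0 q, HasDerivWithinAt (fun s => z (q - s)) (-f (z (q - s))) (Ici s) s := by
    intro z₀ S z hz hS
    refine ⟨(hz.continuousOn hS).comp (by fun_prop) hmaps, fun s hs => ?_⟩
    have hs' : (0 : ℝ) < q - s := by linarith [hs.2]
    have h := hz.hasDerivAt hs' ((EReal.coe_le_coe_iff.2 (by linarith [hs.1])).trans_lt hS)
    have := h.scomp s ((hasDerivAt_id s).const_sub q)
    simpa [Function.comp_def] using this.hasDerivWithinAt
  have hneg : LipschitzOnWith C (fun p => -f p) K := fun a ha b hb => by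
    simpa [edist_neg_neg] using hC ha hb
  have := dist_le_of_trajectories_ODE_of_mem (v := fun _ p => -f p) (s := fun _ => K)
    (fun _ _ => hneg) (key hx hqT).1 (key hx hqT).2
    (fun s hs => hxK _ (hmaps (Ico_subset_Icc_self hs))) (key hy hqT').1 (key hy hqT').2
    (fun s hs => hyK _ (hmaps (Ico_subset_Icc_self hs))) le_rfl q ⟨hq, le_rfl⟩
  simpa [hx.init, hy.init, mul_comm] using this

end ODE

/-! ### Change of time -/

section Reparam

variable {E : Type*} [NormedAddCommGroup E] [NormedSpace ℝ E]

/-- If `ẋ = s' • V x` on an open interval `(a, T)` with `s' > 0`, then `x`, run in the new time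
`s`, is an integral curve of `V`. It is defined for all future times if `s` is unbounded. -/
lemma exists_reparam {V : E → E} {x : ℝ → E} {s s' : ℝ → ℝ} {a t₀ : ℝ} {T : EReal}
    (ha : a < t₀) (hT : (t₀ : EReal) < T) (hs0 : s t₀ = 0)
    (hs : ∀ t : ℝ, a < t → (t : EReal) < T → HasDerivAt s (s' t) t)
    (hpos : ∀ t : ℝ, a < t → (t : EReal) < T → 0 < s' t)
    (hx : ∀ t : ℝ, a < t → (t : EReal) < T → HasDerivAt x (s' t • V (x t)) t)
    (hunb : ∀ C : ℝ, ∃ t : ℝ, t₀ ≤ t ∧ (t : EReal) < T ∧ C ≤ s t) :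
    ∃ y : ℝ → E, y 0 = x t₀ ∧ ∀ σ, 0 ≤ σ → HasDerivAt y (V (y σ)) σ ∧
      ∃ t : ℝ, t₀ ≤ t ∧ (t : EReal) < T ∧ y σ = x t := by
  set J : Set ℝ := {t | a < t ∧ (t : EReal) < T} with hJ
  have hJo : IsOpen J :=
    isOpen_Ioi.inter (isOpen_Iio.preimage continuous_coe_real_ereal)
  have hJc : OrdConnected J := by
    refine ⟨fun u hu v hv w hw => ⟨hu.1.trans_le hw.1, ?_⟩⟩
    exact (EReal.coe_le_coe_iff.2 hw.2).trans_lt hv.2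
  have hJconv : Convex ℝ J := hJc.convex
  have htJ : t₀ ∈ J := ⟨ha, hT⟩
  have hcont : ContinuousOn s J := fun t ht => (hs t ht.1 ht.2).continuousAt.continuousWithinAt
  have hmono : StrictMonoOn s J := strictMonoOn_of_deriv_pos hJconv hcont fun t ht => by
    have ht' := interior_subset ht
    rw [(hs t ht'.1 ht'.2).deriv]
    exact hpos t ht'.1 ht'.2
  obtain ⟨t₁, ht₁J, ht₁⟩ : ∃ t₁ ∈ J, t₁ < t₀ :=
    ⟨(a + t₀) / 2, ⟨by linarith, (EReal.coe_lt_coe_iff.2 (by linarith)).trans hT⟩, by linarith⟩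
  have hst₁ : s t₁ < 0 := hs0 ▸ hmono ht₁J htJ ht₁
  -- every time after `s t₁` is reached
  have hsurj : ∀ σ, s t₁ ≤ σ → ∃ t ∈ J, s t = σ := fun σ hσ => by
    obtain ⟨t₂, h₁, h₂, h₃⟩ := hunb σ
    have ht₂J : t₂ ∈ J := ⟨ha.trans_le h₁, h₂⟩
    obtain ⟨t, ht, rfl⟩ := intermediate_value_Icc (ht₁.le.trans h₁)
      (hcont.mono (hJc.out ht₁J ht₂J)) ⟨hσ, h₃⟩
    exact ⟨t, hJc.out ht₁J ht₂J ht, rfl⟩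
  choose! τ hτJ hτ using hsurj
  have hτmono : StrictMonoOn τ (Ici (s t₁)) := fun u hu v hv huv => by
    rwa [← hmono.lt_iff_lt (hτJ u hu) (hτJ v hv), hτ u hu, hτ v hv]
  have hτs : ∀ t ∈ J, s t₁ ≤ s t → τ (s t) = t := fun t ht h =>
    hmono.injOn (hτJ _ h) ht (hτ _ h)
  have hτ0 : τ 0 = t₀ := by
    rw [← hs0]; exact hτs t₀ htJ (hs0 ▸ hst₁.le)
  refine ⟨fun σ => x (τ σ), by simp [hτ0], fun σ hσ => ⟨?_, τ σ, ?_, ?_, rfl⟩⟩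
  · have hσ1 : s t₁ < σ := hst₁.trans_le hσ
    have hnhds : Ici (s t₁) ∈ 𝓝 σ := Ici_mem_nhds hσ1
    have hJσ := hτJ σ hσ1.le
    have hcτ : ContinuousAt τ σ := by
      refine hτmono.continuousAt_of_image_mem_nhds hnhds ?_
      have hgt : t₁ < τ σ := by
        rwa [← hmono.lt_iff_lt ht₁J hJσ, hτ σ hσ1.le]
      filter_upwards [hJo.mem_nhds hJσ, Ioi_mem_nhds hgt] with t ht htt
      have h : s t₁ ≤ s t := (hmono ht₁J ht htt).le
      exact ⟨s t, h, hτs t ht h⟩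
    have hne := (hpos _ hJσ.1 hJσ.2).ne'
    have hdτ : HasDerivAt τ (s' (τ σ))⁻¹ σ :=
      (hs _ hJσ.1 hJσ.2).of_local_left_inverse hcτ hne
        (by filter_upwards [hnhds] with u hu using hτ u hu)
    have := (hx _ hJσ.1 hJσ.2).scomp σ hdτ
    simpa [Function.comp_def, smul_smul, inv_mul_cancel₀ hne] using this
  · rw [← hτ0]
    exact hτmono.monotoneOn hst₁.le (hst₁.le.trans hσ) hσ
  · exact (hτJ σ (hst₁.le.trans hσ)).2

end Reparam

section Inner

variable {E : Type*} [NormedAddCommGroup E] [InnerProductSpace ℝ E]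

/-- A curve that tends to a zero `ξ` of a vector field `V` with `‖V p‖ ≤ L ‖p - ξ‖`, and follows it
in the time `s`, needs infinite time `s` to get there: `log ‖x - ξ‖² + 2 L s` is monotone. -/
lemma time_unbounded {V : E → E} {ξ : E} {x : ℝ → E} {s s' : ℝ → ℝ} {t₀ L : ℝ} {T : EReal}
    (hT : (t₀ : EReal) < T)
    (hs : ∀ t : ℝ, t₀ ≤ t → (t : EReal) < T → HasDerivAt s (s' t) t)
    (hpos : ∀ t : ℝ, t₀ ≤ t → (t : EReal) < T → 0 < s' t)
    (hx : ∀ t : ℝ, t₀ ≤ t → (t : EReal) < T → HasDerivAt x (s' t • V (x t)) t)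
    (hne : ∀ t : ℝ, t₀ ≤ t → (t : EReal) < T → x t ≠ ξ)
    (hV : ∀ t : ℝ, t₀ ≤ t → (t : EReal) < T → ‖V (x t)‖ ≤ L * ‖x t - ξ‖)
    (hlim : ∀ ε > 0, ∃ t : ℝ, t₀ ≤ t ∧ (t : EReal) < T ∧ dist (x t) ξ < ε) (hL : 0 ≤ L) (C : ℝ) :
    ∃ t : ℝ, t₀ ≤ t ∧ (t : EReal) < T ∧ C ≤ s t := by
  by_contra! hcon
  set J : Set ℝ := {t | t₀ ≤ t ∧ (t : EReal) < T} with hJ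
  have hJc : OrdConnected J := by
    refine ⟨fun u hu v hv w hw => ⟨hu.1.trans hw.1, ?_⟩⟩
    exact (EReal.coe_le_coe_iff.2 hw.2).trans_lt hv.2
  have hpos2 : ∀ t ∈ J, 0 < ‖x t - ξ‖ ^ 2 := fun t ht => by
    have := norm_pos_iff.2 (sub_ne_zero.2 (hne t ht.1 ht.2)); positivity
  have hd : ∀ t ∈ J, HasDerivAt (fun t => Real.log (‖x t - ξ‖ ^ 2) + 2 * L * s t)
      (2 * inner ℝ (x t - ξ) (s' t • V (x t)) / ‖x t - ξ‖ ^ 2 + 2 * L * s' t) t := fun t ht =>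
    ((((hx t ht.1 ht.2).sub_const ξ).norm_sq).log (hpos2 t ht).ne').add
      ((hs t ht.1 ht.2).const_mul _)
  have hmono : MonotoneOn (fun t => Real.log (‖x t - ξ‖ ^ 2) + 2 * L * s t) J := by
    refine monotoneOn_of_hasDerivWithinAt_nonneg hJc.convex
      (fun t ht => (hd t ht).continuousAt.continuousWithinAt)
      (fun t ht => (hd t (interior_subset ht)).hasDerivWithinAt) fun t ht => ?_
    have ht := interior_subset ht
    have h1 : |inner ℝ (x t - ξ) (V (x t))| ≤ L * ‖x t - ξ‖ ^ 2 := by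
      refine (abs_real_inner_le_norm _ _).trans ?_
      nlinarith [hV t ht.1 ht.2, norm_nonneg (x t - ξ)]
    have h2 := (abs_le.1 h1).1
    have h3 := hpos t ht.1 ht.2
    rw [inner_smul_right, div_add' _ _ _ (hpos2 t ht).ne']
    refine div_nonneg ?_ (hpos2 t ht).le
    nlinarith [mul_le_mul_of_nonneg_left h2 h3.le]
  set c := Real.log (‖x t₀ - ξ‖ ^ 2) + 2 * L * s t₀ - 2 * L * C with hc
  obtain ⟨t, h1, h2, h3⟩ := hlim (Real.exp (c / 2)) (Real.exp_pos _)
  have h4 := hmono ⟨le_rfl, hT⟩ ⟨h1, h2⟩ h1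
  have h5 : Real.log (‖x t - ξ‖ ^ 2) < c := by
    rw [Real.log_lt_iff_lt_exp (hpos2 t ⟨h1, h2⟩)]
    rw [dist_eq_norm] at h3
    calc ‖x t - ξ‖ ^ 2 < Real.exp (c / 2) ^ 2 := by gcongr
      _ = Real.exp c := by rw [← Real.exp_nat_mul]; congr 1; push_cast; ring
  have h6 : 2 * L * s t ≤ 2 * L * C :=
    mul_le_mul_of_nonneg_left (hcon t h1 h2).le (by positivity)
  simp only at h4
  linarith

end Inner

/-! ### Instability of critical points -/

section Instability

variable {E : Type*} [NormedAddCommGroup E] [InnerProductSpace ℝ E]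

/-- `x` is trapped near `ξ`: the integral curve of `V` from `x` exists for all future times and
stays in the ball of radius `ρ` around `ξ`. -/
def Trapped (V : E → E) (ξ : E) (ρ : ℝ) (x : E) : Prop :=
  ∃ y : ℝ → E, y 0 = x ∧ ∀ σ, 0 ≤ σ → HasDerivAt y (V (y σ)) σ ∧ y σ ∈ Metric.ball ξ ρ

/-- For a symmetric operator `L` the quadratic form of `L` is controlled by `‖L w‖²`: the component
of `w` in the kernel of `L` is orthogonal to the range of `L`. -/
lemma exists_abs_inner_le_norm_sq [FiniteDimensional ℝ E] (L : E →L[ℝ] E)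
    (hL : ∀ v w, inner ℝ (L v) w = inner ℝ v (L w)) :
    ∃ K : ℝ, 0 < K ∧ ∀ w, |inner ℝ w (L w)| ≤ K * ‖L w‖ ^ 2 := by
  obtain ⟨g, hg⟩ := (L : E →ₗ[ℝ] E).rangeRestrict.exists_rightInverse_of_surjective
    (LinearMap.range_rangeRestrict _)
  have hg' : ∀ w, L (g ((L : E →ₗ[ℝ] E).rangeRestrict w)) = L w := fun w => by
    have := LinearMap.congr_fun hg ((L : E →ₗ[ℝ] E).rangeRestrict w)
    simpa using congrArg Subtype.val this
  set G := LinearMap.toContinuousLinearMap g with hG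
  refine ⟨‖G‖ + 1, by positivity, fun w => ?_⟩
  set w' := g ((L : E →ₗ[ℝ] E).rangeRestrict w) with hw'
  have h1 : ‖w'‖ ≤ ‖G‖ * ‖L w‖ := G.le_opNorm ((L : E →ₗ[ℝ] E).rangeRestrict w)
  have h2 : inner ℝ w (L w) = inner ℝ w' (L w) := by
    have : inner ℝ (L (w - w')) w = (0 : ℝ) := by rw [map_sub, hg', sub_self, inner_zero_left]
    rw [hL, inner_sub_left] at this
    linarith
  rw [h2]
  refine (abs_real_inner_le_norm _ _).trans ?_
  nlinarith [norm_nonneg (L w), mul_le_mul_of_nonneg_right h1 (norm_nonneg (L w))]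

/-- The differential inequality behind the instability: where `F = Q - δ N²` is positive it grows
at a rate proportional to itself. Here `q`, `N`, `p` stand for `Q(w)`, `‖w‖`, `‖e L w‖`, while `a`
and `b` are the derivatives of `Q` and `δ N²` along the difference `w` of two solutions, and `ε`
bounds the deviation of the field from its linearization. -/
lemma growth_estimate {k K C δ ε N p q a b : ℝ} (hk : 0 < k) (hK : 0 < K) (hδ : 0 < δ)
    (hε : 0 ≤ ε) (hC : 0 ≤ C) (hN : 0 ≤ N) (hp : 0 ≤ p)
    (hδ' : 16 * C ^ 2 * K * δ ≤ k ^ 2) (hε' : 16 * ε ^ 2 * K ≤ k ^ 2 * δ) (hε'' : 4 * ε * K ≤ k)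
    (hq : q ≤ K * p ^ 2) (ha : 2 * k * p ^ 2 - 2 * ε * N * p ≤ a)
    (hb : b ≤ 2 * δ * (C * p * N) + 2 * δ * ε * N ^ 2) (hF : 0 < q - δ * N ^ 2) :
    k / (2 * K) * (q - δ * N ^ 2) ≤ a - b := by
  have hN2 : δ * N ^ 2 ≤ K * p ^ 2 := by linarith
  have h0 : k / (2 * K) * (q - δ * N ^ 2) ≤ k / 2 * p ^ 2 := by
    rw [div_mul_eq_mul_div, div_le_iff₀ (by positivity)]
    nlinarith [mul_nonneg hδ.le (sq_nonneg N)]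
  -- the two cross terms are absorbed by means of the arithmetic-geometric mean inequality
  have h1 : 2 * ε * N * p ≤ k / 4 * p ^ 2 + k / 4 * p ^ 2 := by
    have hsq : (ε * N) ^ 2 ≤ (k / 4 * p) ^ 2 := by
      have : (ε * N) ^ 2 * (16 * K * δ) ≤ (k / 4 * p) ^ 2 * (16 * K * δ) := by
        calc (ε * N) ^ 2 * (16 * K * δ) = (16 * ε ^ 2 * K) * (δ * N ^ 2) := by ring
          _ ≤ (k ^ 2 * δ) * (K * p ^ 2) := by gcongr
          _ = (k / 4 * p) ^ 2 * (16 * K * δ) := by ring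
      exact le_of_mul_le_mul_right this (by positivity)
    have := (pow_le_pow_iff_left₀ (by positivity) (by positivity) two_ne_zero).1 hsq
    nlinarith
  have h2 : 2 * δ * (C * p * N) ≤ k / 4 * p ^ 2 + k / 4 * p ^ 2 := by
    have hsq : (δ * C * N) ^ 2 ≤ (k / 4 * p) ^ 2 := by
      have : (δ * C * N) ^ 2 * 16 ≤ (k / 4 * p) ^ 2 * 16 := by
        calc (δ * C * N) ^ 2 * 16 = (16 * C ^ 2 * δ) * (δ * N ^ 2) := by ring
          _ ≤ (16 * C ^ 2 * δ) * (K * p ^ 2) := by gcongr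
          _ = (16 * C ^ 2 * K * δ) * p ^ 2 := by ring
          _ ≤ k ^ 2 * p ^ 2 := by gcongr
          _ = (k / 4 * p) ^ 2 * 16 := by ring
      exact le_of_mul_le_mul_right this (by norm_num)
    have := (pow_le_pow_iff_left₀ (by positivity) (by positivity) two_ne_zero).1 hsq
    nlinarith
  have h3 : 2 * δ * ε * N ^ 2 ≤ k / 2 * p ^ 2 := by
    calc 2 * δ * ε * N ^ 2 = 2 * ε * (δ * N ^ 2) := by ring
      _ ≤ 2 * ε * (K * p ^ 2) := by gcongr
      _ = (4 * ε * K) * p ^ 2 / 2 := by ring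
      _ ≤ k * p ^ 2 / 2 := by gcongr
      _ = k / 2 * p ^ 2 := by ring
  linarith

/-- Let `ξ` be an equilibrium of `V` at which the linearization is `(J - k e) L`, with `L` symmetric
and `J` skew. Two orbits trapped near `ξ` cannot be separated in a direction in which the form
`Q(w) = -e ⟨w, L w⟩` is definitely positive, because there `Q` increases along differences of
solutions: the linearized derivative of `Q` is `2 k ‖e L w‖²`. -/
theorem exists_forall_trapped_inner_le [FiniteDimensional ℝ E] {V : E → E} {ξ : E}
    {A L J : E →L[ℝ] E} {k e : ℝ} (hk : 0 < k) (he : e ≠ 0)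
    (hL : ∀ v w, inner ℝ (L v) w = inner ℝ v (L w)) (hJ : ∀ v, inner ℝ (J v) v = 0)
    (hA : ∀ w, A w = J (L w) - (k * e) • L w) (hV : HasStrictFDerivAt V A ξ) {δ₁ : ℝ}
    (hδ₁ : 0 < δ₁) :
    ∃ ρ > 0, ∀ x y, Trapped V ξ ρ x → Trapped V ξ ρ y →
      -(e * inner ℝ (x - y) (L (x - y))) ≤ δ₁ * ‖x - y‖ ^ 2 := by
  obtain ⟨K₀, hK₀, hKL⟩ := exists_abs_inner_le_norm_sq L hL
  have he' : 0 < |e| := abs_pos.2 he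
  set K := K₀ / |e| with hK
  have hKpos : 0 < K := by positivity
  set C := (‖J‖ + |k * e|) / |e| with hC
  have hCnn : 0 ≤ C := by positivity
  have hQ : ∀ w, -(e * inner ℝ w (L w)) ≤ K * (|e| * ‖L w‖) ^ 2 := fun w => by
    calc -(e * inner ℝ w (L w)) ≤ |e * inner ℝ w (L w)| := neg_le_abs _
      _ = |e| * |inner ℝ w (L w)| := abs_mul _ _
      _ ≤ |e| * (K₀ * ‖L w‖ ^ 2) := by gcongr; exact hKL w
      _ = K * (|e| * ‖L w‖) ^ 2 := by rw [hK]; field_simp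
  have hAC : ∀ w, ‖A w‖ ≤ C * (|e| * ‖L w‖) := fun w => by
    calc ‖A w‖ ≤ ‖J (L w)‖ + ‖(k * e) • L w‖ := by rw [hA]; exact norm_sub_le _ _
      _ ≤ ‖J‖ * ‖L w‖ + |k * e| * ‖L w‖ := by
        rw [norm_smul, Real.norm_eq_abs]; gcongr; exact J.le_opNorm _
      _ = C * (|e| * ‖L w‖) := by rw [hC]; field_simp
  -- `δ` and then `ε` are chosen as `growth_estimate` requires
  set δ := min δ₁ (k ^ 2 / (16 * C ^ 2 * K + 1)) with hδ
  have hδpos : 0 < δ := lt_min hδ₁ (by positivity)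
  have hδk : 16 * C ^ 2 * K * δ ≤ k ^ 2 := by
    have h1 : δ * (16 * C ^ 2 * K + 1) ≤ k ^ 2 :=
      (le_div_iff₀ (by positivity)).1 (min_le_right δ₁ _)
    nlinarith
  set ε := min 1 (min (k ^ 2 * δ / (16 * K)) (k / (4 * K))) with hε
  have hεpos : 0 < ε := by positivity
  have hε1 : 16 * ε ^ 2 * K ≤ k ^ 2 * δ := by
    have h1 : ε * (16 * K) ≤ k ^ 2 * δ :=
      (le_div_iff₀ (by positivity)).1 ((min_le_right _ _).trans (min_le_left _ _))
    have h2 : ε ^ 2 ≤ ε := by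
      have : ε ≤ 1 := min_le_left _ _
      nlinarith
    nlinarith [mul_le_mul_of_nonneg_right h2 hKpos.le]
  have hε2 : 4 * ε * K ≤ k := by
    have h1 : ε * (4 * K) ≤ k :=
      (le_div_iff₀ (by positivity)).1 ((min_le_right _ _).trans (min_le_right _ _))
    linarith
  obtain ⟨ρ, hρ, hVρ⟩ : ∃ ρ > 0, ∀ p ∈ Metric.ball ξ ρ, ∀ q ∈ Metric.ball ξ ρ,
      ‖V p - V q - A (p - q)‖ ≤ ε * ‖p - q‖ := by
    have h := hV.isLittleO.def hεpos
    rw [nhds_prod_eq] at h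
    obtain ⟨s, hs, h⟩ := (Metric.nhds_basis_ball.prod_self.eventually_iff).1 h
    exact ⟨s, hs, fun p hp q hq => h (Set.mk_mem_prod hp hq)⟩
  refine ⟨ρ, hρ, fun x₀ y₀ ⟨x, hx0, hx⟩ ⟨y, hy0, hy⟩ => ?_⟩
  by_contra! hcon
  set w : ℝ → E := fun σ => x σ - y σ with hw
  set F : ℝ → ℝ := fun σ => -(e * inner ℝ (w σ) (L (w σ))) - δ * ‖w σ‖ ^ 2 with hF
  set F' : ℝ → ℝ := fun σ => -(e * (2 * inner ℝ (V (x σ) - V (y σ)) (L (w σ)))) -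
    δ * (2 * inner ℝ (w σ) (V (x σ) - V (y σ))) with hF'
  have hdF : ∀ σ, 0 ≤ σ → HasDerivAt F (F' σ) σ := fun σ hσ => by
    have h1 : HasDerivAt w (V (x σ) - V (y σ)) σ := (hx σ hσ).1.sub (hy σ hσ).1
    have h2 := h1.inner ℝ (L.hasFDerivAt.comp_hasDerivAt σ h1)
    have h3 := ((h2.const_mul e).neg).sub (h1.norm_sq.const_mul δ)
    refine h3.congr_deriv ?_
    simp only [hF', Function.comp]
    rw [← hL (w σ), real_inner_comm (V (x σ) - V (y σ)) (L (w σ))]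
    ring
  have hF0 : 0 < F 0 := by
    have : δ * ‖x₀ - y₀‖ ^ 2 ≤ δ₁ * ‖x₀ - y₀‖ ^ 2 := by gcongr; exact min_le_left _ _
    simp only [hF, hw, hx0, hy0]
    linarith
  have hgrow : ∀ σ, 0 ≤ σ → 0 < F σ → k / (2 * K) * F σ ≤ F' σ := fun σ hσ hpos => by
    have hη := hVρ _ (hx σ hσ).2 _ (hy σ hσ).2
    set η := V (x σ) - V (y σ) - A (x σ - y σ) with hηdef
    have hdecomp : V (x σ) - V (y σ) = A (w σ) + η := by rw [hηdef]; abel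
    simp only [hF']
    rw [hdecomp]
    refine growth_estimate (N := ‖w σ‖) (p := |e| * ‖L (w σ)‖) hk hKpos hδpos hεpos.le hCnn
      (norm_nonneg _) (by positivity) hδk hε1 hε2 (hQ (w σ)) ?_ ?_ hpos
    · have h1 : inner ℝ (A (w σ)) (L (w σ)) = -(k * e) * ‖L (w σ)‖ ^ 2 := by
        rw [hA, inner_sub_left, hJ, inner_smul_left, real_inner_self_eq_norm_sq]
        simp
      have h2 : e * inner ℝ η (L (w σ)) ≤ ε * ‖w σ‖ * (|e| * ‖L (w σ)‖) := by
        calc e * inner ℝ η (L (w σ)) ≤ |e| * |inner ℝ η (L (w σ))| := by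
              rw [← abs_mul]; exact le_abs_self _
          _ ≤ |e| * (‖η‖ * ‖L (w σ)‖) := by gcongr; exact abs_real_inner_le_norm _ _
          _ ≤ |e| * ((ε * ‖w σ‖) * ‖L (w σ)‖) := by gcongr
          _ = _ := by ring
      rw [inner_add_left, h1, mul_pow, sq_abs]
      nlinarith
    · have h1 : inner ℝ (w σ) (A (w σ)) ≤ ‖w σ‖ * (C * (|e| * ‖L (w σ)‖)) :=
        (real_inner_le_norm _ _).trans (by gcongr; exact hAC _)
      have h2 : inner ℝ (w σ) η ≤ ‖w σ‖ * (ε * ‖w σ‖) :=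
        (real_inner_le_norm _ _).trans (by gcongr)
      rw [inner_add_right]
      have := mul_le_mul_of_nonneg_left (add_le_add h1 h2) (by positivity : 0 ≤ 2 * δ)
      linarith
  set M := K * (|e| * (‖L‖ * (2 * ρ))) ^ 2 with hM
  have hM0 : 0 ≤ M := by positivity
  have hbound : ∀ σ, 0 ≤ σ → F σ ≤ M := fun σ hσ => by
    have h1 : ‖w σ‖ ≤ 2 * ρ := by
      have h2 := (hx σ hσ).2
      have h3 := (hy σ hσ).2
      rw [Metric.mem_ball] at h2 h3
      rw [← dist_eq_norm]
      linarith [dist_triangle_right (x σ) (y σ) ξ]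
    have h2 : ‖L (w σ)‖ ≤ ‖L‖ * (2 * ρ) := (L.le_opNorm _).trans (by gcongr)
    calc F σ ≤ -(e * inner ℝ (w σ) (L (w σ))) := by
          simp only [hF]; linarith [mul_nonneg hδpos.le (sq_nonneg ‖w σ‖)]
      _ ≤ K * (|e| * ‖L (w σ)‖) ^ 2 := hQ _
      _ ≤ M := by rw [hM]; gcongr
  -- `F` stays above a line of slope `c`, which contradicts its boundedness
  set c := k / (4 * K) * F 0 with hc
  have hcpos : 0 < c := by positivity
  have hline : ∀ ⦃σ⦄, σ ∈ Icc 0 (M / c) → -F σ ≤ -(F 0 + c * σ) := by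
    refine image_le_of_deriv_right_lt_deriv_boundary (f' := fun σ => -F' σ)
      (B' := fun _ => -c)
      (fun σ hσ => (hdF σ hσ.1).neg.continuousAt.continuousWithinAt)
      (fun σ hσ => (hdF σ hσ.1).neg.hasDerivWithinAt) (by simp) (fun σ => ?_) fun σ hσ hEq => ?_
    · exact ((((hasDerivAt_id' σ).const_mul c).const_add (F 0)).neg).congr_deriv (by ring)
    · have h1 : F σ = F 0 + c * σ := neg_injective hEq
      have h2 : F 0 ≤ F σ := by rw [h1]; linarith [mul_nonneg hcpos.le hσ.1]
      have h3 := hgrow σ hσ.1 (hF0.trans_le h2)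
      have h4 : k / (2 * K) * F 0 ≤ k / (2 * K) * F σ := by gcongr
      have h5 : k / (2 * K) * F 0 = 2 * c := by rw [hc]; field_simp; norm_num
      linarith
  have h1 := hline ⟨by positivity, le_rfl⟩
  have h2 := hbound (M / c) (by positivity)
  rw [mul_div_cancel₀ _ hcpos.ne'] at h1
  linarith

end Instability

/-! ### Null sets and limits -/

/-- A planar set with a real-valued function that does not contract distances by more than a
constant factor has Hausdorff dimension at most `1`, hence measure zero. -/
lemma volume_eq_zero_of_dist_le {D : Set Plane} {g : Plane → ℝ} {C : ℝ}
    (h : ∀ x ∈ D, ∀ y ∈ D, dist x y ≤ C * dist (g x) (g y)) :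
    MeasureTheory.volume D = 0 := by
  have hinj : InjOn g D := fun x hx y hy hxy => by
    have := h x hx y hy
    rw [hxy, dist_self, mul_zero] at this
    exact dist_le_zero.1 this
  have hlip : LipschitzOnWith (Real.toNNReal C) (Function.invFunOn g D) (g '' D) := by
    refine LipschitzOnWith.of_dist_le_mul ?_
    rintro _ ⟨x, hx, rfl⟩ _ ⟨y, hy, rfl⟩
    rw [hinj.leftInvOn_invFunOn hx, hinj.leftInvOn_invFunOn hy]
    exact (h x hx y hy).trans (by gcongr; exact Real.le_coe_toNNReal C)
  have hdim : dimH D ≤ 1 := by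
    calc dimH D = dimH (Function.invFunOn g D '' (g '' D)) := by
          rw [hinj.leftInvOn_invFunOn.image_image]
      _ ≤ dimH (g '' D) := hlip.dimH_image_le
      _ ≤ dimH (univ : Set ℝ) := dimH_mono (subset_univ _)
      _ = 1 := Real.dimH_univ
  have hH : MeasureTheory.Measure.hausdorffMeasure (2 : NNReal) D = 0 :=
    hausdorffMeasure_of_dimH_lt (hdim.trans_lt (by norm_num))
  have : (MeasureTheory.Measure.hausdorffMeasure
      (Module.finrank ℝ Plane) : MeasureTheory.Measure Plane).IsAddHaarMeasure := inferInstance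
  have hf : ((Module.finrank ℝ Plane : ℕ) : ℝ) = ((2 : NNReal) : ℝ) := by simp
  rw [hf] at this
  exact MeasureTheory.Measure.absolutelyContinuous_isAddHaarMeasure _ _ hH

/-- A curve whose distance to a finite set tends to zero converges to one of its points. -/
lemma exists_tendsto_of_finite {X : Type*} [MetricSpace X] {S : Set X} (hS : S.Finite) {r : ℝ → X}
    (hr : ContinuousOn r (Ici 0))
    (h : ∀ κ > 0, ∃ t₀ : ℝ, 0 ≤ t₀ ∧ ∀ t ≥ t₀, ∃ p ∈ S, dist (r t) p < κ) :
    ∃ p ∈ S, Tendsto r atTop (𝓝 p) := by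
  obtain ⟨κ, hκ, hsep⟩ : ∃ κ > 0, ∀ p ∈ S, ∀ q ∈ S, p ≠ q → κ ≤ dist p q := by
    by_cases hn : S.Nontrivial
    · exact ⟨S.infsep, (hS.infsep_pos_iff_nontrivial).2 hn,
        fun p hp q hq hpq => Set.infsep_le_dist_of_mem hp hq hpq⟩
    · exact ⟨1, one_pos, fun p hp q hq hpq => absurd ⟨p, hp, q, hq, hpq⟩ hn⟩
  obtain ⟨t₀, ht₀, h₀⟩ := h (κ / 2) (by positivity)
  obtain ⟨p, hp, hpt⟩ := h₀ t₀ le_rfl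
  have hdisj : ∀ q ∈ S, ∀ x, dist x p < κ / 2 → dist x q < κ / 2 → q = p := fun q hq x h1 h2 => by
    by_contra hne
    linarith [hsep q hq p hp hne, dist_triangle_left q p x]
  have hstay : ∀ t ≥ t₀, dist (r t) p < κ / 2 := fun t ht => by
    have hconn : IsPreconnected (r '' Ici t₀) :=
      isPreconnected_Ici.image r (hr.mono (Ici_subset_Ici.2 ht₀))
    refine hconn.subset_left_of_subset_union (u := Metric.ball p (κ / 2))
      (v := ⋃ q ∈ S \ {p}, Metric.ball q (κ / 2)) Metric.isOpen_ball
      (isOpen_biUnion fun _ _ => Metric.isOpen_ball) ?_ ?_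
      ⟨r t₀, mem_image_of_mem r self_mem_Ici, hpt⟩
      (mem_image_of_mem r ht)
    · refine disjoint_left.2 fun x hx hx' => ?_
      simp only [mem_iUnion, Metric.mem_ball] at hx hx'
      obtain ⟨q, hq, hxq⟩ := hx'
      exact hq.2 (hdisj q hq.1 x hx hxq)
    · rintro _ ⟨s, hs, rfl⟩
      obtain ⟨q, hq, hqs⟩ := h₀ s hs
      by_cases hqp : q = p
      · exact Or.inl (hqp ▸ hqs)
      · exact Or.inr (mem_biUnion (show q ∈ S \ {p} from ⟨hq, hqp⟩) hqs)
  refine ⟨p, hp, Metric.tendsto_atTop.2 fun ε hε => ?_⟩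
  obtain ⟨t₁, -, h₁⟩ := h (min ε (κ / 2)) (by positivity)
  refine ⟨max t₀ t₁, fun t ht => ?_⟩
  obtain ⟨q, hq, hqt⟩ := h₁ t ((le_max_right _ _).trans ht)
  have := hdisj q hq (r t) (hstay t ((le_max_left _ _).trans ht)) (hqt.trans_le (min_le_right _ _))
  rw [← this]
  exact hqt.trans_le (min_le_left _ _)

/-! ### The guiding vector field -/

/-- The rotation `E` with rows `(0, 1)` and `(-1, 0)`. -/
def rot : Plane →L[ℝ] Plane :=
  LinearMap.toContinuousLinearMap
    { toFun := fun p => !₂[p 1, -p 0]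
      map_add' := fun p q => by ext i; fin_cases i <;> simp; ring
      map_smul' := fun c p => by ext i; fin_cases i <;> simp }

lemma rot_apply (p : Plane) : rot p = !₂[p 1, -p 0] := rfl

lemma inner_rot_self (p : Plane) : inner ℝ (rot p) p = 0 := by
  simp [rot_apply, PiLp.inner_apply, Fin.sum_univ_two]; ring

lemma norm_sq_rot (p : Plane) : ‖rot p‖ ^ 2 = ‖p‖ ^ 2 := by
  simp [rot_apply, EuclideanSpace.norm_sq_eq, Fin.sum_univ_two]; ring

variable {φ : Plane → ℝ} {ψ : ℝ → ℝ} {kn ur : ℝ}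

lemma inner_normal (p w : Plane) : inner ℝ (normal φ p) w = fderiv ℝ φ p w := by
  rw [normal, gradient, InnerProductSpace.toDual_symm_apply]

lemma contDiff_normal (hφ : ContDiff ℝ 2 φ) : ContDiff ℝ 1 (normal φ) :=
  (InnerProductSpace.toDual ℝ Plane).symm.contDiff.comp (hφ.fderiv_right (by norm_num))

lemma contDiff_err (hφ : ContDiff ℝ 2 φ) (hψ : ContDiff ℝ 1 ψ) : ContDiff ℝ 1 (err φ ψ) :=
  hψ.comp (hφ.of_le (by norm_num))

lemma field_eq (p : Plane) :
    field φ ψ kn p = rot (normal φ p) - (kn * err φ ψ p) • normal φ p := rfl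

lemma contDiff_field (hφ : ContDiff ℝ 2 φ) (hψ : ContDiff ℝ 1 ψ) :
    ContDiff ℝ 1 (field φ ψ kn) := by
  have h1 := contDiff_normal hφ
  exact (rot.contDiff.comp h1).sub ((contDiff_const.mul (contDiff_err hφ hψ)).smul h1)

lemma inner_normal_field (p : Plane) :
    inner ℝ (normal φ p) (field φ ψ kn p) = -(kn * err φ ψ p) * ‖normal φ p‖ ^ 2 := by
  rw [field_eq, inner_sub_right, real_inner_comm, inner_rot_self, inner_smul_right,
    real_inner_self_eq_norm_sq]
  ring

lemma norm_sq_field (p : Plane) :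
    ‖field φ ψ kn p‖ ^ 2 = (1 + (kn * err φ ψ p) ^ 2) * ‖normal φ p‖ ^ 2 := by
  rw [field_eq, norm_sub_sq_real, norm_sq_rot, inner_smul_right, inner_rot_self, norm_smul,
    mul_pow, Real.norm_eq_abs, sq_abs]
  ring

lemma field_eq_zero_iff {p : Plane} : field φ ψ kn p = 0 ↔ p ∈ critSet φ := by
  have h := norm_sq_field (φ := φ) (ψ := ψ) (kn := kn) p
  have h1 : 1 + (kn * err φ ψ p) ^ 2 ≠ 0 := by positivity
  rw [← norm_eq_zero, ← sq_eq_zero_iff, h, mul_eq_zero, or_iff_right h1, sq_eq_zero_iff,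
    norm_eq_zero]
  rfl

lemma norm_field_pos {p : Plane} (hp : p ∉ critSet φ) : 0 < ‖field φ ψ kn p‖ :=
  norm_pos_iff.2 fun h => hp (field_eq_zero_iff.1 h)

lemma isOpen_compl_critSet (hφ : ContDiff ℝ 2 φ) : IsOpen (critSet φ)ᶜ :=
  (isClosed_singleton.preimage (contDiff_normal hφ).continuous).isOpen_compl

lemma contDiffAt_velocity (hφ : ContDiff ℝ 2 φ) (hψ : ContDiff ℝ 1 ψ) {p : Plane}
    (hp : p ∈ (critSet φ)ᶜ) : ContDiffAt ℝ 1 (fun p => ur • guide φ ψ kn p) p := by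
  have h := (contDiff_field (kn := kn) hφ hψ).contDiffAt (x := p)
  have h0 : field φ ψ kn p ≠ 0 := fun h => hp (field_eq_zero_iff.1 h)
  exact (contDiffAt_const (c := ur)).smul (((h.norm ℝ h0).inv (norm_ne_zero_iff.2 h0)).smul h)

lemma nnnorm_velocity_le (hur : 0 < ur) (p : Plane) :
    ‖ur • guide φ ψ kn p‖₊ ≤ Real.toNNReal ur := by
  rw [← NNReal.coe_le_coe, coe_nnnorm, Real.coe_toNNReal _ hur.le, norm_smul, Real.norm_eq_abs,
    abs_of_pos hur, guide, norm_smul, norm_inv, norm_norm]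
  exact mul_le_of_le_one_right hur.le (inv_mul_le_one)

/-- The derivative within `[0, T)` and the derivative within `[0, ∞)` agree at times in `[0, T)`. -/
lemma isSolution_iff {r₀ : Plane} {T : EReal} {r : ℝ → Plane} :
    IsSolution φ ψ kn ur r₀ T r ↔ IsSol (fun p => ur • guide φ ψ kn p) (critSet φ)ᶜ r₀ T r := by
  have key : ∀ t ∈ timeInterval T, ∀ v : Plane,
      HasDerivWithinAt r v (timeInterval T) t ↔ HasDerivWithinAt r v (Ici 0) t := fun t ht v => by
    refine hasDerivWithinAt_congr_set ?_
    have : ∀ᶠ s : ℝ in 𝓝 t, (s : EReal) < T :=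
      continuous_coe_real_ereal.continuousAt.eventually_lt continuousAt_const ht.2
    filter_upwards [this] with s hs
    exact propext ⟨fun h => h.1, fun h => ⟨h, hs⟩⟩
  constructor
  · exact fun h => ⟨h.init, fun t h0 ht => h.regular t ⟨h0, ht⟩,
      fun t h0 ht => (key t ⟨h0, ht⟩ _).1 (h.ode t ⟨h0, ht⟩)⟩
  · exact fun h => ⟨h.init, fun t ht => h.mem t ht.1 ht.2,
      fun t ht => (key t ht _).2 (h.deriv t ht.1 ht.2)⟩

/-! ### Linearization at a critical point -/

/-- The Hessian of `φ` as an operator: the derivative of the normal field. -/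
def hessOp (φ : Plane → ℝ) (p : Plane) : Plane →L[ℝ] Plane := fderiv ℝ (normal φ) p

lemma hasStrictFDerivAt_normal (hφ : ContDiff ℝ 2 φ) (p : Plane) :
    HasStrictFDerivAt (normal φ) (hessOp φ p) p :=
  (contDiff_normal hφ).contDiffAt.hasStrictFDerivAt (by norm_num)

lemma inner_hessOp (hφ : ContDiff ℝ 2 φ) (p v w : Plane) :
    inner ℝ (hessOp φ p v) w = fderiv ℝ (fderiv ℝ φ) p v w := by
  have h1 : HasFDerivAt (fun q => inner ℝ (normal φ q) w)
      ((innerSL ℝ w).comp (hessOp φ p)) p := by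
    have := (innerSL ℝ w).hasFDerivAt.comp p (hasStrictFDerivAt_normal hφ p).hasFDerivAt
    simpa [Function.comp_def, real_inner_comm] using this
  have h2 : HasFDerivAt (fun q => fderiv ℝ φ q w)
      ((ContinuousLinearMap.apply ℝ ℝ w).comp (fderiv ℝ (fderiv ℝ φ) p)) p := by
    have hd : DifferentiableAt ℝ (fderiv ℝ φ) p :=
      (hφ.fderiv_right (m := 1) (by norm_num)).differentiable (by norm_num) p
    exact (ContinuousLinearMap.apply ℝ ℝ w).hasFDerivAt.comp p hd.hasFDerivAt
  simp_rw [inner_normal] at h1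
  have := congrArg (fun A => A v) (h1.unique h2)
  simpa [real_inner_comm] using this

lemma hessOp_symm (hφ : ContDiff ℝ 2 φ) (p v w : Plane) :
    inner ℝ (hessOp φ p v) w = inner ℝ v (hessOp φ p w) := by
  rw [inner_hessOp hφ, real_inner_comm, inner_hessOp hφ]
  exact (hφ.contDiffAt.isSymmSndFDerivAt (by simp)).eq v w

lemma hessian_apply (hφ : ContDiff ℝ 2 φ) (p : Plane) (i j : Fin 2) :
    hessian φ p i j = hessOp φ p (EuclideanSpace.single j 1) i := by
  have hd : DifferentiableAt ℝ (fderiv ℝ φ) p :=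
    (hφ.fderiv_right (m := 1) (by norm_num)).differentiable (by norm_num) p
  have h2 : HasFDerivAt (fun q => fderiv ℝ φ q (EuclideanSpace.single j 1))
      ((ContinuousLinearMap.apply ℝ ℝ (EuclideanSpace.single j (1 : ℝ))).comp
        (fderiv ℝ (fderiv ℝ φ) p)) p :=
    (ContinuousLinearMap.apply ℝ ℝ (EuclideanSpace.single j (1 : ℝ))).hasFDerivAt.comp p
      hd.hasFDerivAt
  rw [hessian, Matrix.of_apply, h2.fderiv]
  have := inner_hessOp hφ p (EuclideanSpace.single i 1) (EuclideanSpace.single j 1)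
  rw [hessOp_symm hφ, EuclideanSpace.inner_single_left, map_one, one_mul] at this
  exact this.symm

lemma hessian_mulVec (hφ : ContDiff ℝ 2 φ) (p : Plane) (u : Fin 2 → ℝ) :
    (hessian φ p).mulVec u = WithLp.ofLp (hessOp φ p (WithLp.toLp 2 u)) := by
  have hu : WithLp.toLp 2 u =
      u 0 • EuclideanSpace.single (0 : Fin 2) (1 : ℝ) + u 1 • EuclideanSpace.single 1 1 := by
    ext i; fin_cases i <;> simp
  ext i
  rw [hu, map_add, map_smul, map_smul]
  simp [Matrix.mulVec, dotProduct, Fin.sum_univ_two, hessian_apply hφ, mul_comm]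

/-- At a critical point the derivative of `e` does not contribute to the linearization of `v`. -/
lemma hasStrictFDerivAt_field (hφ : ContDiff ℝ 2 φ) (hψ : ContDiff ℝ 1 ψ) {p : Plane}
    (hp : p ∈ critSet φ) :
    HasStrictFDerivAt (field φ ψ kn)
      (rot.comp (hessOp φ p) - (kn * err φ ψ p) • hessOp φ p) p := by
  have h1 := hasStrictFDerivAt_normal hφ p
  have h2 : HasStrictFDerivAt (fun q => kn * err φ ψ q) (fderiv ℝ (fun q => kn * err φ ψ q) p) p :=
    (contDiff_const.mul (contDiff_err hφ hψ)).contDiffAt.hasStrictFDerivAt one_ne_zero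
  have h0 : normal φ p = 0 := hp
  have h3 := (rot.hasStrictFDerivAt.comp p h1).sub (h2.smul h1)
  refine h3.congr_fderiv ?_
  ext w i
  simp [h0]

lemma err_ne_zero (hψmono : StrictMono ψ) (hψ0 : ψ 0 = 0) (hcrit : CritSeparated φ) {p : Plane}
    (hp : p ∈ critSet φ) : err φ ψ p ≠ 0 := by
  intro h
  have h0 : φ p = 0 := hψmono.injective (by rw [hψ0]; exact h)
  have h1 : Metric.infEDist p (path φ) = 0 :=
    Metric.infEDist_zero_of_mem (show p ∈ path φ from h0)
  exact absurd (h1 ▸ hcrit.trans_le (iInf₂_le p hp)) (lt_irrefl _)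

/-- The local instability theorem at a critical point of `φ`. -/
lemma exists_forall_trapped_field (hkn : 0 < kn) (hφ : ContDiff ℝ 2 φ) (hψ : ContDiff ℝ 1 ψ)
    (hψmono : StrictMono ψ) (hψ0 : ψ 0 = 0) (hcrit : CritSeparated φ) {ξ : Plane}
    (hξ : ξ ∈ critSet φ) {δ : ℝ} (hδ : 0 < δ) :
    ∃ ρ > 0, ∀ x y, Trapped (field φ ψ kn) ξ ρ x → Trapped (field φ ψ kn) ξ ρ y →
      -(err φ ψ ξ * inner ℝ (x - y) (hessOp φ ξ (x - y))) ≤ δ * ‖x - y‖ ^ 2 :=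
  exists_forall_trapped_inner_le hkn (err_ne_zero hψmono hψ0 hcrit hξ) (hessOp_symm hφ ξ)
    inner_rot_self (fun w => by simp) (hasStrictFDerivAt_field hφ hψ hξ) hδ

/-! ### Solutions that avoid the critical points converge to the path -/

lemma mul_comp_pos (hψmono : StrictMono ψ) (hψ0 : ψ 0 = 0) {a : ℝ} (ha : a ≠ 0) : 0 < a * ψ a := by
  rcases lt_or_gt_of_ne ha with h | h
  · exact mul_pos_of_neg_of_neg h (hψ0 ▸ hψmono h)
  · exact mul_pos h (hψ0 ▸ hψmono h)

lemma IsSol.dist_le (hur : 0 < ur) {r₀ : Plane} {r : ℝ → Plane}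
    (hr : IsSol (fun p => ur • guide φ ψ kn p) (critSet φ)ᶜ r₀ ⊤ r) {s t : ℝ} (hs : 0 ≤ s)
    (hst : s ≤ t) : dist (r t) (r s) ≤ ur * (t - s) := by
  have h := (convex_Ici (0 : ℝ)).lipschitzOnWith_of_nnnorm_hasDerivWithin_le
    (fun t ht => hr.deriv t ht (EReal.coe_lt_top t))
    (fun t _ => nnnorm_velocity_le (φ := φ) (ψ := ψ) (kn := kn) hur (r t))
  have := h.dist_le_mul t (hs.trans hst) s hs
  rwa [Real.coe_toNNReal _ hur.le, Real.dist_eq, abs_of_nonneg (sub_nonneg.2 hst)] at this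

/-- Along a solution, `φ²` decreases: only the component of the field along `∇φ` matters. -/
lemma hasDerivWithinAt_sq (hφ : ContDiff ℝ 2 φ) {r₀ : Plane} {T : EReal} {r : ℝ → Plane}
    (hr : IsSol (fun p => ur • guide φ ψ kn p) (critSet φ)ᶜ r₀ T r) {t : ℝ} (h0 : 0 ≤ t)
    (ht : (t : EReal) < T) :
    HasDerivWithinAt (fun s => φ (r s) ^ 2)
      (-(2 * ur * kn * (φ (r t) * err φ ψ (r t)) * ‖normal φ (r t)‖ ^ 2 / ‖field φ ψ kn (r t)‖))
      (Ici 0) t := by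
  have h1 : HasFDerivAt φ (fderiv ℝ φ (r t)) (r t) :=
    (hφ.differentiable (by norm_num) (r t)).hasFDerivAt
  have h2 := (h1.comp_hasDerivWithinAt t (hr.deriv t h0 ht)).pow 2
  refine h2.congr_deriv ?_
  rw [← inner_normal, guide, inner_smul_right, inner_smul_right, inner_normal_field]
  simp only [Function.comp]
  push_cast
  ring

/-- Where `φ²` lies between two positive bounds, it decreases at least at the rate `c ‖∇φ‖`. -/
lemma exists_decay_rate (hkn : 0 < kn) (hur : 0 < ur) (hψ : ContDiff ℝ 1 ψ)
    (hψmono : StrictMono ψ) (hψ0 : ψ 0 = 0) {ℓ m : ℝ} (hℓ : 0 < ℓ) :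
    ∃ c > 0, ∀ p ∉ critSet φ, ℓ ≤ φ p ^ 2 → φ p ^ 2 ≤ m →
      c * ‖normal φ p‖ ≤
        2 * ur * kn * (φ p * err φ ψ p) * ‖normal φ p‖ ^ 2 / ‖field φ ψ kn p‖ := by
  set S : Set ℝ := {a | ℓ ≤ a ^ 2 ∧ a ^ 2 ≤ m} with hS
  have hScomp : IsCompact S := by
    refine Metric.isCompact_of_isClosed_isBounded ?_ ?_
    · exact (isClosed_le continuous_const (continuous_pow 2)).inter
        (isClosed_le (continuous_pow 2) continuous_const)
    · refine (Metric.isBounded_Icc (-(m + 1)) (m + 1)).subset fun a ha => ?_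
      constructor <;> nlinarith [ha.1, ha.2, sq_nonneg (a + 1), sq_nonneg (a - 1)]
  have hcont : Continuous ψ := hψ.continuous
  obtain ⟨c₁, hc₁, hc₁S⟩ : ∃ c₁ > 0, ∀ a ∈ S, c₁ ≤ a * ψ a := by
    rcases S.eq_empty_or_nonempty with h | h
    · exact ⟨1, one_pos, by simp [h]⟩
    · obtain ⟨a, ha, hmin⟩ := hScomp.exists_isMinOn h
        (f := fun a => a * ψ a) (by fun_prop)
      refine ⟨a * ψ a, mul_comp_pos hψmono hψ0 fun h0 => ?_, fun b hb => hmin hb⟩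
      have := ha.1
      rw [h0] at this
      norm_num at this
      linarith
  obtain ⟨M, hM⟩ : ∃ M, ∀ a ∈ S, ‖ψ a‖ ≤ M := hScomp.exists_bound_of_continuousOn hcont.continuousOn
  set M' := 1 + kn * |M| with hM'
  have hM'pos : 0 < M' := by positivity
  refine ⟨2 * ur * kn * c₁ / M', by positivity, fun p hp h1 h2 => ?_⟩
  have hn : 0 < ‖normal φ p‖ := norm_pos_iff.2 hp
  have hv := norm_field_pos (ψ := ψ) (kn := kn) hp
  have hvle : ‖field φ ψ kn p‖ ≤ M' * ‖normal φ p‖ := by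
    refine (pow_le_pow_iff_left₀ (norm_nonneg _) (by positivity) two_ne_zero).1 ?_
    rw [norm_sq_field, mul_pow M']
    gcongr
    have h3 : |kn * err φ ψ p| ≤ kn * |M| := by
      rw [abs_mul, abs_of_pos hkn]
      exact mul_le_mul_of_nonneg_left ((hM _ ⟨h1, h2⟩).trans (le_abs_self M)) hkn.le
    have h4 : (kn * err φ ψ p) ^ 2 ≤ (kn * |M|) ^ 2 := by
      rw [← sq_abs (kn * err φ ψ p)]; gcongr
    have h5 : 0 ≤ kn * |M| := by positivity
    rw [hM']; nlinarith
  have h3 : c₁ ≤ φ p * err φ ψ p := hc₁S _ ⟨h1, h2⟩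
  generalize φ p * err φ ψ p = a at h3 ⊢
  have ha : 0 < a := hc₁.trans_le h3
  rw [le_div_iff₀ hv, div_mul_eq_mul_div, div_mul_eq_mul_div, div_le_iff₀ hM'pos]
  calc 2 * ur * kn * c₁ * ‖normal φ p‖ * ‖field φ ψ kn p‖
      ≤ 2 * ur * kn * a * ‖normal φ p‖ * (M' * ‖normal φ p‖) := by gcongr
    _ = _ := by ring

/-- A global solution converges to the path or to a critical point. If `φ²` does not tend to `0`,
the time spent away from the critical points, where `φ²` decreases at a definite rate, is finite,
so that the distance to the finite critical set tends to `0`. -/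
lemma IsSol.tendsto_path_or_crit (hkn : 0 < kn) (hur : 0 < ur) (hφ : ContDiff ℝ 2 φ)
    (hψ : ContDiff ℝ 1 ψ) (hψmono : StrictMono ψ) (hψ0 : ψ 0 = 0) (herr : ErrSeparated φ ψ)
    (hnormal : NormalSeparated φ) (hfin : (critSet φ).Finite) {r₀ : Plane} {r : ℝ → Plane}
    (hr : IsSol (fun p => ur • guide φ ψ kn p) (critSet φ)ᶜ r₀ ⊤ r) :
    Tendsto (fun t => Metric.infEDist (r t) (path φ)) atTop (𝓝 0) ∨
      ∃ ξ ∈ critSet φ, Tendsto r atTop (𝓝 ξ) := by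
  set g : ℝ → ℝ := fun t => φ (r t) ^ 2 with hg
  have hd := fun (t : ℝ) (h0 : 0 ≤ t) => hasDerivWithinAt_sq hφ hr h0 (EReal.coe_lt_top t)
  have hgcont : ContinuousOn g (Ici 0) := fun t ht => (hd t ht).continuousWithinAt
  have hrcont : ContinuousOn r (Ici 0) := fun t ht =>
    (hr.deriv t ht (EReal.coe_lt_top t)).continuousWithinAt
  have hanti : AntitoneOn g (Ici 0) := by
    refine antitoneOn_of_hasDerivWithinAt_nonpos (convex_Ici 0) hgcont
      (fun t ht => (hd t (interior_subset ht)).mono interior_subset) fun t ht => ?_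
    have h1 : 0 ≤ φ (r t) * err φ ψ (r t) := by
      rcases eq_or_ne (φ (r t)) 0 with h | h
      · simp [h]
      · exact (mul_comp_pos hψmono hψ0 h).le
    have : 0 ≤ 2 * ur * kn * (φ (r t) * err φ ψ (r t)) * ‖normal φ (r t)‖ ^ 2 /
      ‖field φ ψ kn (r t)‖ := by positivity
    linarith
  obtain ⟨ℓ, hℓ⟩ : ∃ ℓ, Tendsto g atTop (𝓝 ℓ) := by
    have h1 : Antitone fun t => g (max t 0) := fun s t hst =>
      hanti (le_max_right s 0) (le_max_right t 0) (max_le_max_right 0 hst)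
    refine ⟨_, (tendsto_atTop_ciInf h1 ⟨0, ?_⟩).congr' ?_⟩
    · rintro _ ⟨t, rfl⟩; positivity
    · filter_upwards [eventually_ge_atTop 0] with t ht
      rw [max_eq_left ht]
  have hℓ0 : 0 ≤ ℓ := ge_of_tendsto' hℓ fun t => sq_nonneg _
  have hgℓ : ∀ t, 0 ≤ t → ℓ ≤ g t := fun t ht => by
    refine le_of_tendsto hℓ ?_
    filter_upwards [eventually_ge_atTop t] with s hs using hanti ht (ht.trans hs) hs
  rcases hℓ0.eq_or_lt with h0 | hpos
  · left
    have h1 : Tendsto (fun t => φ (r t)) atTop (𝓝 0) := by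
      rw [tendsto_zero_iff_abs_tendsto_zero]
      have := (Real.continuous_sqrt.tendsto ℓ).comp hℓ
      simpa [← h0, Function.comp_def, hg, Real.sqrt_sq_eq_abs] using this
    have h2 : Tendsto (fun t => |err φ ψ (r t)|) atTop (𝓝 0) := by
      have := ((hψ.continuous.tendsto 0).comp h1).abs
      simpa [hψ0, Function.comp_def, err] using this
    rw [ENNReal.tendsto_nhds_zero]
    intro ε hε
    obtain ⟨κ, hκ, hκε⟩ := ENNReal.lt_iff_exists_nnreal_btwn.1 hε
    have hκ' : (0 : ℝ) < κ := by exact_mod_cast hκ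
    obtain ⟨c, hc, hce⟩ := herr κ hκ'
    filter_upwards [h2.eventually_lt_const hc] with t ht
    by_contra! hlt
    refine absurd (hce (r t) ?_) (not_le.2 ht)
    rw [ENNReal.ofReal_coe_nnreal]
    exact (hκε.trans hlt).le
  · right
    obtain ⟨c, hc, hcn⟩ := exists_decay_rate (φ := φ) (m := g 0) hkn hur hψ hψmono hψ0 hpos
    refine exists_tendsto_of_finite hfin hrcont fun κ hκ => ?_
    obtain ⟨b, hb, hbn⟩ := hnormal (κ / 2) (by positivity)
    set Δ := κ / 2 / ur with hΔ
    have hΔpos : 0 < Δ := by positivity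
    have hdiff : Tendsto (fun t => g t - g (t + Δ)) atTop (𝓝 0) := by
      simpa using hℓ.sub (hℓ.comp (tendsto_atTop_add_const_right _ Δ tendsto_id))
    obtain ⟨t₀, ht₀⟩ := eventually_atTop.1
      (hdiff.eventually_lt_const (show 0 < c * b * Δ by positivity))
    refine ⟨max t₀ 0, le_max_right _ _, fun t ht => ?_⟩
    have ht0 : 0 ≤ t := (le_max_right _ _).trans ht
    by_contra! hfar
    refine absurd (ht₀ t ((le_max_left _ _).trans ht)) (not_lt.2 ?_)
    have hsub : Icc t (t + Δ) ⊆ Ici 0 := fun s hs => ht0.trans hs.1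
    -- the speed is at most `ur`, so that the curve stays away from the critical set during `[t, t + Δ]`
    have hnear : ∀ s ∈ Icc t (t + Δ), b ≤ ‖normal φ (r s)‖ := fun s hs => by
      refine hbn _ (Metric.le_infEDist.2 fun p hp => ?_)
      rw [edist_dist]
      refine ENNReal.ofReal_le_ofReal ?_
      have h1 := hr.dist_le hur ht0 hs.1
      have h2 : ur * (s - t) ≤ κ / 2 := by
        calc ur * (s - t) ≤ ur * Δ := by gcongr; linarith [hs.2]
          _ = κ / 2 := by rw [hΔ]; field_simp
      linarith [hfar p hp, dist_triangle_left (r t) p (r s)]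
    have hanti2 : AntitoneOn (fun s => g s + c * b * s) (Icc t (t + Δ)) := by
      refine antitoneOn_of_hasDerivWithinAt_nonpos (convex_Icc _ _)
        ((hgcont.mono hsub).add (by fun_prop))
        (fun s hs => ((hd s (hsub (interior_subset hs))).mono
          (interior_subset.trans hsub)).add ((hasDerivWithinAt_id s _).const_mul (c * b)))
        fun s hs => ?_
      have hs := interior_subset hs
      have h1 := hcn (r s) (hr.mem s (hsub hs) (EReal.coe_lt_top s)) (hgℓ s (hsub hs))
        (hanti self_mem_Ici (hsub hs) (hsub hs))
      have h2 := mul_le_mul_of_nonneg_left (hnear s hs) hc.le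
      linarith
    have := hanti2 ⟨le_rfl, by linarith⟩ ⟨by linarith, le_rfl⟩ (by linarith)
    simp only at this
    linarith

/-! ### Solutions that converge to a critical point -/

/-- The curve `x` converges to `ξ` at the end of the time interval `[0, T)`, where `T` may be
`+∞`. -/
def ConvergesAt (x : ℝ → Plane) (T : EReal) (ξ : Plane) : Prop :=
  ∀ ε > 0, ∃ t₀ : ℝ, 0 ≤ t₀ ∧ (t₀ : EReal) < T ∧
    ∀ t : ℝ, t₀ ≤ t → (t : EReal) < T → dist (x t) ξ < ε

/-- In the time of the unnormalized field `v`, a solution that converges to a critical point lasts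
forever; hence it is trapped near that point from some moment on. -/
lemma IsSol.eventually_trapped (hur : 0 < ur) (hφ : ContDiff ℝ 2 φ) (hψ : ContDiff ℝ 1 ψ)
    {r₀ ξ : Plane} {T : EReal} {r : ℝ → Plane}
    (hr : IsSol (fun p => ur • guide φ ψ kn p) (critSet φ)ᶜ r₀ T r) (hξ : ξ ∈ critSet φ)
    (hlim : ConvergesAt r T ξ) {ρ : ℝ} (hρ : 0 < ρ) :
    ∃ t₀ : ℝ, 0 ≤ t₀ ∧ (t₀ : EReal) < T ∧
      ∀ q : ℝ, t₀ < q → (q : EReal) < T → Trapped (field φ ψ kn) ξ ρ (r q) := by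
  set V := field φ ψ kn with hV
  have hV0 : V ξ = 0 := field_eq_zero_iff.2 hξ
  have hVc : ContDiff ℝ 1 V := contDiff_field hφ hψ
  obtain ⟨L, s, hs, hL⟩ := hVc.contDiffAt.exists_lipschitzOnWith (x := ξ)
  obtain ⟨ε, hε, hεs⟩ := Metric.mem_nhds_iff.1 hs
  obtain ⟨t₀, h0, h0T, hclose⟩ := hlim (min ε ρ) (lt_min hε hρ)
  refine ⟨t₀, h0, h0T, fun q hq hqT => ?_⟩
  have hvpos : ∀ t : ℝ, 0 < t → (t : EReal) < T → 0 < ‖V (r t)‖ := fun t ht htT =>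
    norm_field_pos (hr.mem t ht.le htT)
  have hq0 : 0 < q := h0.trans_lt hq
  set J : Set ℝ := {t | 0 < t ∧ (t : EReal) < T} with hJ
  have hJo : IsOpen J := isOpen_Ioi.inter (isOpen_Iio.preimage continuous_coe_real_ereal)
  have hJc : OrdConnected J := by
    refine ⟨fun u hu v hv w hw => ⟨hu.1.trans_le hw.1, ?_⟩⟩
    exact (EReal.coe_le_coe_iff.2 hw.2).trans_lt hv.2
  -- the rate of the new time
  set s' : ℝ → ℝ := fun t => ur / ‖V (r t)‖ with hs'
  have hrc : ContinuousOn r J := fun t ht =>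
    (hr.hasDerivAt ht.1 ht.2).continuousAt.continuousWithinAt
  have hs'c : ContinuousOn s' J :=
    continuousOn_const.div (hVc.continuous.norm.comp_continuousOn hrc)
      fun t ht => (hvpos t ht.1 ht.2).ne'
  have hds : ∀ t : ℝ, 0 < t → (t : EReal) < T →
      HasDerivAt (fun t => ∫ u in q..t, s' u) (s' t) t := fun t ht htT => by
    refine intervalIntegral.integral_hasDerivAt_right ?_ ?_ (hs'c.continuousAt
      (hJo.mem_nhds ⟨ht, htT⟩))
    · exact (hs'c.mono (hJc.uIcc_subset ⟨hq0, hqT⟩ ⟨ht, htT⟩)).intervalIntegrable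
    · exact hs'c.stronglyMeasurableAtFilter hJo _ ⟨ht, htT⟩
  have hs'pos : ∀ t : ℝ, 0 < t → (t : EReal) < T → 0 < s' t := fun t ht htT =>
    div_pos hur (hvpos t ht htT)
  have hdr : ∀ t : ℝ, 0 < t → (t : EReal) < T → HasDerivAt r (s' t • V (r t)) t :=
    fun t ht htT => by
      refine (hr.hasDerivAt ht htT).congr_deriv ?_
      rw [guide, smul_smul, ← div_eq_mul_inv]
  have hafter : ∀ {t : ℝ}, q ≤ t → 0 < t := fun h => hq0.trans_le h
  obtain ⟨y, hy0, hy⟩ := exists_reparam (V := V) (x := r) hq0 hqT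
    (intervalIntegral.integral_same) hds hs'pos hdr
    (time_unbounded (ξ := ξ) (V := V) (x := r) (L := L) hqT (fun t h => hds t (hafter h))
      (fun t h => hs'pos t (hafter h)) (fun t h => hdr t (hafter h))
      (fun t h htT heq => hr.mem t (hafter h).le htT (heq ▸ hξ))
      (fun t h htT => by
        have h1 : r t ∈ s := hεs ((hclose t (hq.le.trans h) htT).trans_le (min_le_left _ _))
        have := hL.norm_sub_le h1 (mem_of_mem_nhds hs)
        rwa [hV0, sub_zero] at this)
      (fun η hη => by
        obtain ⟨t₁, -, h1T, h1⟩ := hlim η hη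
        refine ⟨max q t₁, le_max_left _ _, ?_, h1 _ (le_max_right _ _) ?_⟩
        all_goals rcases max_choice q t₁ with h | h <;> rw [h] <;> assumption)
      L.coe_nonneg)
  refine ⟨y, hy0, fun σ hσ => ⟨(hy σ hσ).1, ?_⟩⟩
  obtain ⟨t, hqt, htT, hyt⟩ := (hy σ hσ).2
  rw [hyt]
  exact (hclose t (hq.le.trans hqt) htT).trans_le (min_le_right _ _)

/-- `r₀` is bad for `ξ` if some solution from `r₀`, on a finite or infinite interval, converges to
the critical point `ξ`. -/
def badSet (φ : Plane → ℝ) (ψ : ℝ → ℝ) (kn ur : ℝ) (ξ : Plane) : Set Plane :=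
  {r₀ | ∃ T : EReal, 0 < T ∧ ∃ r,
    IsSol (fun p => ur • guide φ ψ kn p) (critSet φ)ᶜ r₀ T r ∧ ConvergesAt r T ξ}

/-- Convergence to a critical point, in finite or infinite time, is the only obstruction to global
convergence to the path. -/
lemma globalConvergence_of_notMem_badSet (hkn : 0 < kn) (hur : 0 < ur) (hφ : ContDiff ℝ 2 φ)
    (hψ : ContDiff ℝ 1 ψ) (hψmono : StrictMono ψ) (hψ0 : ψ 0 = 0) (herr : ErrSeparated φ ψ)
    (hnormal : NormalSeparated φ) (hfin : (critSet φ).Finite) {r₀ : Plane} (hr₀ : r₀ ∉ critSet φ)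
    (hbad : ∀ ξ ∈ critSet φ, r₀ ∉ badSet φ ψ kn ur ξ) : GlobalConvergence φ ψ kn ur r₀ := by
  have hf : ∀ p ∈ (critSet φ)ᶜ, ContDiffAt ℝ 1 (fun p => ur • guide φ ψ kn p) p :=
    fun p hp => contDiffAt_velocity hφ hψ hp
  have hglob : ∃ R, IsSol (fun p => ur • guide φ ψ kn p) (critSet φ)ᶜ r₀ ⊤ R := by
    rcases exists_isSol_top_or_tendsto (isOpen_compl_critSet hφ) hf
      (fun p _ => nnnorm_velocity_le hur p) hr₀ with h | ⟨T, hT, r, hr, ξ, hξ, hlim⟩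
    · exact h
    · rw [notMem_compl_iff] at hξ
      refine absurd ⟨T, by exact_mod_cast hT, r, hr, fun ε hε => ?_⟩ (hbad ξ hξ)
      have h1 := (hlim.eventually (Metric.ball_mem_nhds ξ hε)).and (Ioo_mem_nhdsLT hT)
      obtain ⟨b, hb, hbT⟩ := mem_nhdsLT_iff_exists_Ico_subset.1 h1
      have hb' : b < T := hb
      refine ⟨b, (hbT ⟨le_rfl, hb'⟩).2.1.le, EReal.coe_lt_coe_iff.2 hb', fun t ht htT => ?_⟩
      exact (hbT ⟨ht, EReal.coe_lt_coe_iff.1 htT⟩).1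
  obtain ⟨R, hR⟩ := hglob
  have hRlim : Tendsto (fun t => Metric.infEDist (R t) (path φ)) atTop (𝓝 0) := by
    refine (hR.tendsto_path_or_crit hkn hur hφ hψ hψmono hψ0 herr hnormal hfin).resolve_right ?_
    rintro ⟨ξ, hξ, hlim⟩
    refine hbad ξ hξ ⟨⊤, by simp, R, hR, fun ε hε => ?_⟩
    obtain ⟨t₀, ht₀⟩ := Metric.tendsto_atTop.1 hlim ε hε
    exact ⟨max t₀ 0, le_max_right _ _, EReal.coe_lt_top _,
      fun t ht _ => ht₀ t ((le_max_left _ _).trans ht)⟩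
  refine ⟨⟨R, isSolution_iff.2 hR⟩, fun T hT r hr => ⟨R, isSolution_iff.2 hR, ?_, hRlim⟩⟩
  exact fun t ht => hR.unique hf (isSolution_iff.1 hr) ht.1 (EReal.coe_lt_top t) ht.2

/-! ### Exceptional initial points -/

lemma inner_hessOp_eq_dotProduct (hφ : ContDiff ℝ 2 φ) (p w : Plane) :
    inner ℝ w (hessOp φ p w) =
      dotProduct (WithLp.ofLp w) ((hessian φ p).mulVec (WithLp.ofLp w)) := by
  rw [hessian_mulVec hφ]
  simp [PiLp.inner_apply, dotProduct, mul_comm]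

lemma exists_pos_mul_norm_sq_le (hφ : ContDiff ℝ 2 φ) {ξ : Plane}
    (hpd : (-(err φ ψ ξ • hessian φ ξ)).PosDef) :
    ∃ a > 0, ∀ w, a * ‖w‖ ^ 2 ≤ -(err φ ψ ξ * inner ℝ w (hessOp φ ξ w)) := by
  set Q : Plane → ℝ := fun w => -(err φ ψ ξ * inner ℝ w (hessOp φ ξ w)) with hQ
  have hpos : ∀ w, w ≠ 0 → 0 < Q w := fun w hw => by
    have hw' : WithLp.ofLp w ≠ 0 := fun h => hw (by ext i; simp [h])
    have := hpd.dotProduct_mulVec_pos hw'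
    simp only [hQ, inner_hessOp_eq_dotProduct hφ]
    rw [Matrix.neg_mulVec, Matrix.smul_mulVec, dotProduct_neg, dotProduct_smul, star_trivial,
      smul_eq_mul] at this
    exact this
  have hcont : Continuous Q := by fun_prop
  obtain ⟨w₀, hw₀, hmin⟩ := (isCompact_sphere (0 : Plane) 1).exists_isMinOn
    (NormedSpace.sphere_nonempty.2 zero_le_one) hcont.continuousOn
  have hw₀' : w₀ ≠ 0 := fun h => by simp [h] at hw₀
  refine ⟨Q w₀, hpos w₀ hw₀', fun w => ?_⟩
  rcases eq_or_ne w 0 with rfl | hw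
  · simp
  · have hn : 0 < ‖w‖ := norm_pos_iff.2 hw
    have h1 : Q w₀ ≤ Q (‖w‖⁻¹ • w) := hmin (by simp [norm_smul, hn.ne'])
    have h2 : Q (‖w‖⁻¹ • w) * ‖w‖ ^ 2 = Q w := by
      simp only [hQ, map_smul, inner_smul_left, inner_smul_right]
      simp
      field_simp
    calc Q w₀ * ‖w‖ ^ 2 ≤ Q (‖w‖⁻¹ • w) * ‖w‖ ^ 2 := by gcongr
      _ = Q w := h2

/-- If `e H` is negative definite at `ξ`, the equilibrium is the only point trapped near it, so that
no solution converges to `ξ`. -/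
lemma badSet_eq_empty (hkn : 0 < kn) (hur : 0 < ur) (hφ : ContDiff ℝ 2 φ) (hψ : ContDiff ℝ 1 ψ)
    (hψmono : StrictMono ψ) (hψ0 : ψ 0 = 0) (hcrit : CritSeparated φ) {ξ : Plane}
    (hξ : ξ ∈ critSet φ) (hpd : (-(err φ ψ ξ • hessian φ ξ)).PosDef) :
    badSet φ ψ kn ur ξ = ∅ := by
  refine eq_empty_of_forall_notMem fun r₀ ⟨T, hT, r, hr, hlim⟩ => ?_
  obtain ⟨a, ha, hQ⟩ := exists_pos_mul_norm_sq_le hφ hpd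
  obtain ⟨ρ, hρ, h⟩ := exists_forall_trapped_field hkn hφ hψ hψmono hψ0 hcrit hξ (half_pos ha)
  obtain ⟨t₀, h0, h0T, htr⟩ := hr.eventually_trapped hur hφ hψ hξ hlim hρ
  obtain ⟨q, hq, hqT⟩ := EReal.lt_iff_exists_real_btwn.1 h0T
  have hq' : t₀ < q := EReal.coe_lt_coe_iff.1 hq
  have hξtr : Trapped (field φ ψ kn) ξ ρ ξ := ⟨fun _ => ξ, rfl, fun σ _ =>
    ⟨by simpa [field_eq_zero_iff.2 hξ] using hasDerivAt_const σ ξ, Metric.mem_ball_self hρ⟩⟩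
  have h1 := h _ _ (htr q hq' hqT) hξtr
  have h2 := hQ (r q - ξ)
  have hne : r q - ξ ≠ 0 := fun h =>
    hr.mem q (h0.trans hq'.le) hqT (by rwa [sub_eq_zero.1 h])
  have h3 : 0 < ‖r q - ξ‖ ^ 2 := by have := norm_pos_iff.2 hne; positivity
  nlinarith

/-- Outside the unstable cone around an eigenvector `u` for a negative eigenvalue of `m`, a vector is
controlled by its component orthogonal to `u`. -/
lemma exists_norm_le_of_eigenvector {m : Plane →L[ℝ] Plane}
    (hm : ∀ v w, inner ℝ (m v) w = inner ℝ v (m w)) {u : Plane} (hu : ‖u‖ = 1) {μ : ℝ}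
    (hμ : μ < 0) (hmu : m u = μ • u) :
    ∃ C : ℝ, 0 ≤ C ∧ ∀ w, -inner ℝ w (m w) ≤ -μ / 2 * ‖w‖ ^ 2 →
      ‖w‖ ≤ C * |inner ℝ (rot u) w| := by
  set D := 1 + (‖m‖ - μ / 2) / (-μ / 2) with hD
  have hμ2 : 0 < -μ / 2 := by linarith
  have hnum : 0 ≤ ‖m‖ - μ / 2 := by linarith [norm_nonneg m]
  have hDpos : 0 ≤ D := by positivity
  refine ⟨√D, Real.sqrt_nonneg _, fun w hw => ?_⟩
  set α : ℝ := inner ℝ u w with hα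
  set β : ℝ := inner ℝ (rot u) w with hβ
  have hu2 : u 0 ^ 2 + u 1 ^ 2 = 1 := by
    have := EuclideanSpace.norm_sq_eq u
    rw [hu] at this
    simpa [Fin.sum_univ_two] using this.symm
  have hαc : α = w 0 * u 0 + w 1 * u 1 := by
    simp [hα, PiLp.inner_apply, Fin.sum_univ_two]
  have hβc : β = w 0 * u 1 - w 1 * u 0 := by
    simp [hβ, rot_apply, PiLp.inner_apply, Fin.sum_univ_two]; ring
  have hdec : w = α • u + β • rot u := by
    ext i
    fin_cases i
    · simp [rot_apply, hαc, hβc]; linear_combination -(w 0) * hu2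
    · simp [rot_apply, hαc, hβc]; linear_combination -(w 1) * hu2
  have hnorm : ‖w‖ ^ 2 = α ^ 2 + β ^ 2 := by
    rw [EuclideanSpace.norm_sq_eq, Fin.sum_univ_two, hαc, hβc, Real.norm_eq_abs,
      Real.norm_eq_abs, sq_abs, sq_abs]
    linear_combination -(w 0 ^ 2 + w 1 ^ 2) * hu2
  have hrot : ‖rot u‖ ^ 2 = 1 := by rw [norm_sq_rot, hu, one_pow]
  have hcross : inner ℝ u (m (rot u)) = 0 := by
    rw [← hm, hmu, inner_smul_left, real_inner_comm, inner_rot_self, mul_zero]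
  have hform : inner ℝ w (m w) = μ * α ^ 2 + β ^ 2 * inner ℝ (rot u) (m (rot u)) := by
    conv_lhs => rw [hdec]
    simp only [map_add, map_smul, inner_add_left, inner_add_right, inner_smul_left,
      inner_smul_right, hmu, hcross, inner_rot_self, real_inner_self_eq_norm_sq, hu]
    simp
    ring
  have hb : inner ℝ (rot u) (m (rot u)) ≤ ‖m‖ := by
    calc inner ℝ (rot u) (m (rot u)) ≤ ‖rot u‖ * ‖m (rot u)‖ := real_inner_le_norm _ _
      _ ≤ ‖rot u‖ * (‖m‖ * ‖rot u‖) := by gcongr; exact m.le_opNorm _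
      _ = ‖m‖ := by rw [mul_left_comm, ← sq, hrot, mul_one]
  have hb' := mul_le_mul_of_nonneg_left hb (sq_nonneg β)
  have hαβ : α ^ 2 ≤ (‖m‖ - μ / 2) / (-μ / 2) * β ^ 2 := by
    rw [div_mul_eq_mul_div, le_div_iff₀ hμ2]
    rw [hform, hnorm] at hw
    nlinarith
  have hfin : ‖w‖ ^ 2 ≤ (√D * |β|) ^ 2 := by
    rw [mul_pow, Real.sq_sqrt hDpos, sq_abs, hnorm, hD]
    linarith
  exact (pow_le_pow_iff_left₀ (norm_nonneg _) (by positivity) two_ne_zero).1 hfin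

/-- If `e H` has a negative eigenvalue at `ξ`, the points trapped near `ξ` lie on a Lipschitz graph,
hence have Hausdorff dimension at most `1`. So do their preimages under the flow for a fixed time,
and countably many of these preimages cover the bad set of `ξ`. -/
lemma volume_badSet (hkn : 0 < kn) (hur : 0 < ur) (hφ : ContDiff ℝ 2 φ) (hψ : ContDiff ℝ 1 ψ)
    (hψmono : StrictMono ψ) (hψ0 : ψ 0 = 0) (hcrit : CritSeparated φ) {ξ : Plane}
    (hξ : ξ ∈ critSet φ) {μ : ℝ} (hμ : μ < 0)
    (hev : Module.End.HasEigenvalue (Matrix.toLin' (err φ ψ ξ • hessian φ ξ)) μ) :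
    MeasureTheory.volume (badSet φ ψ kn ur ξ) = 0 := by
  set m := err φ ψ ξ • hessOp φ ξ with hm
  obtain ⟨u, hu, hmu⟩ : ∃ u : Plane, ‖u‖ = 1 ∧ m u = μ • u := by
    obtain ⟨v, hv⟩ := hev.exists_hasEigenvector
    have hv0 : WithLp.toLp 2 v ≠ (0 : Plane) := fun h => hv.2 (by simpa using h)
    have hmv : m (WithLp.toLp 2 v) = μ • WithLp.toLp 2 v := by
      have h := hv.apply_eq_smul
      rw [Matrix.toLin'_apply, Matrix.smul_mulVec, hessian_mulVec hφ] at h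
      ext i
      simpa [hm] using congrFun h i
    refine ⟨‖WithLp.toLp 2 v‖⁻¹ • WithLp.toLp 2 v, norm_smul_inv_norm hv0, ?_⟩
    rw [map_smul, hmv, smul_comm]
  have hmsymm : ∀ v w, inner ℝ (m v) w = inner ℝ v (m w) := fun v w => by
    simp [hm, inner_smul_left, inner_smul_right, hessOp_symm hφ]
  obtain ⟨C, hC, hproj⟩ := exists_norm_le_of_eigenvector hmsymm hu hμ hmu
  obtain ⟨ρ, hρ, htrap⟩ := exists_forall_trapped_field hkn hφ hψ hψmono hψ0 hcrit hξ
    (show 0 < -μ / 2 by linarith)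
  set W : Plane → Plane := fun p => ur • guide φ ψ kn p with hW
  -- an exhaustion of the regular points by compact sets
  set K : ℕ → Set Plane := fun N => {p | ‖p‖ ≤ N ∧ 1 ≤ N * ‖normal φ p‖} with hK
  have hncont : Continuous (normal φ) := (contDiff_normal hφ).continuous
  have hKcomp : ∀ N, IsCompact (K N) := fun N => by
    refine Metric.isCompact_of_isClosed_isBounded ?_ ?_
    · exact (isClosed_le continuous_norm continuous_const).inter
        (isClosed_le continuous_const (continuous_const.mul hncont.norm))
    · exact Metric.isBounded_closedBall.subset fun p hp => mem_closedBall_zero_iff.2 hp.1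
  have hKU : ∀ N, K N ⊆ (critSet φ)ᶜ := fun N p hp hpc => by
    have h1 := hp.2
    rw [show normal φ p = 0 from hpc, norm_zero, mul_zero] at h1
    linarith
  set D : ℚ → ℕ → Set Plane := fun q N => {r₀ | ∃ r : ℝ → Plane, ∃ T : EReal, 0 ≤ (q : ℝ) ∧
    ((q : ℝ) : EReal) < T ∧ IsSol W (critSet φ)ᶜ r₀ T r ∧ (∀ t ∈ Icc 0 (q : ℝ), r t ∈ K N) ∧
    Trapped (field φ ψ kn) ξ ρ (r q)} with hD
  have hDnull : ∀ q N, MeasureTheory.volume (D q N) = 0 := fun q N => by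
    obtain ⟨c, hc⟩ := exists_lipschitzOnWith_of_isCompact
      (fun p hp => contDiffAt_velocity (ur := ur) (kn := kn) hφ hψ hp) (hKcomp N) (hKU N)
    choose! R T hR using fun r₀ (h : r₀ ∈ D q N) => h
    refine volume_eq_zero_of_dist_le (g := fun x => inner ℝ (rot u) (R x q))
      (C := Real.exp (c * q) * C) fun x hx y hy => ?_
    obtain ⟨h0, hxT, hxs, hxK, hxtr⟩ := hR x hx
    obtain ⟨-, hyT, hys, hyK, hytr⟩ := hR y hy
    have h1 := dist_init_le_of_lipschitzOnWith hc hxs hys h0 hxT hyT hxK hyK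
    have h2 : dist (R x q) (R y q) ≤
        C * dist (inner ℝ (rot u) (R x q) : ℝ) (inner ℝ (rot u) (R y q)) := by
      rw [dist_eq_norm, Real.dist_eq, ← inner_sub_right]
      refine hproj _ ?_
      have := htrap _ _ hxtr hytr
      simpa [hm, inner_smul_right] using this
    calc dist x y ≤ Real.exp (c * q) * dist (R x q) (R y q) := h1
      _ ≤ Real.exp (c * q) * (C * dist (inner ℝ (rot u) (R x q) : ℝ)
          (inner ℝ (rot u) (R y q))) := by gcongr
      _ = _ := by ring
  refine MeasureTheory.measure_mono_null (fun r₀ ⟨T, hT, r, hr, hlim⟩ => ?_)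
    (MeasureTheory.measure_iUnion_null fun q => MeasureTheory.measure_iUnion_null (hDnull q))
  obtain ⟨t₀, h0, h0T, htr⟩ := hr.eventually_trapped hur hφ hψ hξ hlim hρ
  obtain ⟨q, hq, hqT⟩ := EReal.lt_iff_exists_rat_btwn.1 h0T
  have hq' : t₀ < (q : ℝ) := EReal.coe_lt_coe_iff.1 hq
  have hrc := hr.continuousOn hqT
  have hnpos : ∀ t ∈ Icc 0 (q : ℝ), 0 < ‖normal φ (r t)‖ := fun t ht =>
    norm_pos_iff.2 (hr.mem t ht.1 ((EReal.coe_le_coe_iff.2 ht.2).trans_lt hqT))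
  obtain ⟨b, hb⟩ := isCompact_Icc.exists_bound_of_continuousOn
    (hrc.norm.add ((hncont.norm.comp_continuousOn hrc).inv₀ fun t ht => (hnpos t ht).ne'))
  obtain ⟨N, hN⟩ := exists_nat_ge b
  refine mem_iUnion₂.2 ⟨q, N, r, T, h0.trans hq'.le, hqT, hr, fun t ht => ?_, htr q hq' hqT⟩
  have h1 : ‖r t‖ + ‖normal φ (r t)‖⁻¹ ≤ N := (le_abs_self _).trans ((hb t ht).trans hN)
  have h2 := hnpos t ht
  refine ⟨by linarith [inv_pos.2 h2], ?_⟩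
  rw [← div_le_iff₀ h2, one_div]
  linarith [norm_nonneg (r t)]

end GVF

end

theorem mainTheorem3 (φ : GVF.Plane → ℝ) (ψ : ℝ → ℝ) (kn ur : ℝ)
    (hkn : 0 < kn) (hur : 0 < ur)
    (hφ : ContDiff ℝ 2 φ)
    (hψ : ContDiff ℝ 1 ψ) (hψmono : StrictMono ψ) (hψ0 : ψ 0 = 0)
    (hψsup : BddAbove (Set.range (deriv ψ)))
    (herr : GVF.ErrSeparated φ ψ)
    (hcrit : GVF.CritSeparated φ)
    (hnormal : GVF.NormalSeparated φ)
    (hfin : (GVF.critSet φ).Finite) :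
    ((∀ p ∈ GVF.critSet φ, ∃ μ : ℝ, μ < 0 ∧
        Module.End.HasEigenvalue (Matrix.toLin' (GVF.err φ ψ p • GVF.hessian φ p)) μ) →
      ∀ᵐ r₀ : GVF.Plane, GVF.GlobalConvergence φ ψ kn ur r₀) ∧
    ((∀ p ∈ GVF.critSet φ, (-(GVF.err φ ψ p • GVF.hessian φ p)).PosDef) →
      ∀ r₀ : GVF.Plane, r₀ ∉ GVF.critSet φ → GVF.GlobalConvergence φ ψ kn ur r₀) := by
  refine ⟨fun h => ?_, fun h r₀ hr₀ => ?_⟩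
  · have hnull : MeasureTheory.volume
        (GVF.critSet φ ∪ ⋃ ξ ∈ GVF.critSet φ, GVF.badSet φ ψ kn ur ξ) = 0 := by
      refine MeasureTheory.measure_union_null (hfin.measure_zero _) ?_
      refine (MeasureTheory.measure_biUnion_null_iff hfin.countable).2 fun ξ hξ => ?_
      obtain ⟨μ, hμ, hev⟩ := h ξ hξ
      exact GVF.volume_badSet hkn hur hφ hψ hψmono hψ0 hcrit hξ hμ hev
    filter_upwards [MeasureTheory.compl_mem_ae_iff.2 hnull] with r₀ hr₀
    rw [Set.mem_compl_iff, Set.mem_union, not_or, Set.mem_iUnion₂] at hr₀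
    exact GVF.globalConvergence_of_notMem_badSet hkn hur hφ hψ hψmono hψ0 herr hnormal hfin hr₀.1
      fun ξ hξ hbad => hr₀.2 ⟨ξ, hξ, hbad⟩
  · refine GVF.globalConvergence_of_notMem_badSet hkn hur hφ hψ hψmono hψ0 herr hnormal hfin hr₀
      fun ξ hξ => ?_
    rw [GVF.badSet_eq_empty hkn hur hφ hψ hψmono hψ0 hcrit hξ (h ξ hξ)]
    exact Set.notMem_empty r₀
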